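/- Let $\mathbb{K}\in\{\mathbb{R},\mathbb{C}\}$, $n\in\mathbb{N}$ and $a<b$. Let $P_1\in\mathbb{K}^{n\times n}$ be invertible and self-adjoint, let $P_0\in L^\infty([a,b],\mathbb{K}^{n\times n})$, and let $\widetilde W_B\in\mathbb{K}^{n\times 2n}$ have full rank $n$. Let $E_+$ and $E_-$ be the subspaces of $\mathbb{K}^n$ spanned by the eigenvectors of $P_1$ to positive and to negative eigenvalues, respectively, let $\iota_\pm:E_\pm\to\mathbb{K}^n$ be the embeddings, and put $$P_\pm:=\iota_\pm\iota_\pm^*,\qquad P_1^\pm:=\iota_\pm^*(\pm P_1)\iota_\pm,\qquad Q_\pm:=\iota_\pm\,(P_1^\pm)^{1/2}\,\iota_\pm^* ,$$ where $(\cdot)^{1/2}$ is the nonnegative square root. Then the following holds. 1. There are unique matrices $J,L\in\mathbb{K}^{n\times n}$ with $$\widetilde W_B=\begin{pmatrix} JQ_+-LQ_- & JQ_--LQ_+\end{pmatrix},$$ and they are given by $J=\widetilde W_B\begin{bmatrix}Q_+\\-Q_-\end{bmatrix}P_1^{-1}$ and $L=\widetilde W_B\begin{bmatrix}Q_-\\-Q_+\end{bmatrix}P_1^{-1}$.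 2. The following statements are equivalent: (a) There are matrices $K,M\in\mathbb{K}^{n\times n}$ with $K$ invertible and $\widetilde W_B=K\begin{pmatrix}Q_+-MQ_- & Q_--MQ_+\end{pmatrix}$. (b) The matrix $\widetilde W_B\begin{bmatrix}P_+\\P_-\end{bmatrix}$ is invertible. (c) The operator $A_I:=P_1\frac{\partial}{\partial\xi}+P_0$ with domain $$\mathrm{D}(A_I)=\left\{x\in H^1([a,b],\mathbb{K}^n)\ \middle|\ \widetilde W_B\begin{bmatrix}x(b)\\x(a)\end{bmatrix}=0\right\}$$ is the infinitesimal generator of a $C_0$-semigroup on $L^2([a,b],\mathbb{K}^n)$. (d) The matrix $J$ from Part 1 is invertible. Furthermore, for every pair $K,M$ as in (a) one has $K=\widetilde W_B\begin{bmatrix}Q_+\\-Q_-\end{bmatrix}P_1^{-1}$ and $M=K^{-1}\widetilde W_B\begin{bmatrix}Q_-\\-Q_+\end{bmatrix}P_1^{-1}$. -/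

import Mathlib

open MeasureTheory Filter Topology
open scoped NNReal ENNReal Matrix

noncomputable section

namespace HBCS

section Semigroup

variable {𝕜 : Type*} [RCLike 𝕜] {X : Type*} [NormedAddCommGroup X] [NormedSpace 𝕜 X]

/-- `T` is a strongly continuous (`C₀`) semigroup of bounded linear operators on `X`. -/
structure IsC0Semigroup (T : ℝ≥0 → X →L[𝕜] X) : Prop where
  map_zero : T 0 = ContinuousLinearMap.id 𝕜 X
  map_add : ∀ s t : ℝ≥0, T (s + t) = (T s).comp (T t)
  tendsto_zero : ∀ x : X, Tendsto (fun t : ℝ≥0 => T t x) (𝓝[>] 0) (𝓝 x)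

/-- `A` is the infinitesimal generator of `T`: `x ∈ D(A)` with `A x = y` if and only if
`(T(t) x - x) / t → y` as `t ↓ 0`. -/
def IsInfinitesimalGenerator (A : X →ₗ.[𝕜] X) (T : ℝ≥0 → X →L[𝕜] X) : Prop :=
  ∀ x y : X, (x, y) ∈ A.graph ↔
    Tendsto (fun t : ℝ≥0 => (((t : ℝ) : 𝕜)⁻¹) • (T t x - x)) (𝓝[>] 0) (𝓝 y)

/-- `A` is the infinitesimal generator of some `C₀`-semigroup on `X`. -/
def GeneratesC0Semigroup (A : X →ₗ.[𝕜] X) : Prop :=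
  ∃ T : ℝ≥0 → X →L[𝕜] X, IsC0Semigroup T ∧ IsInfinitesimalGenerator A T

end Semigroup

section SquareRoot

variable {𝕜 : Type*} [RCLike 𝕜] {F : Type*} [NormedAddCommGroup F] [InnerProductSpace 𝕜 F]
  [FiniteDimensional 𝕜 F]

open Classical in
/-- The nonnegative square root of a nonnegative self-adjoint operator `T` on a finite-dimensional
inner product space: `∑ i, √λᵢ ⟨eᵢ, ·⟩ eᵢ` for an orthonormal eigenbasis `eᵢ` of `T` with
eigenvalues `λᵢ` (and `0` for an operator that is not self-adjoint). -/
def opSqrt (T : F →ₗ[𝕜] F) : F →ₗ[𝕜] F :=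
  if h : T.IsSymmetric then
    ∑ i, ((√(h.eigenvalues rfl i) : ℝ) : 𝕜) •
      (InnerProductSpace.rankOne 𝕜 (h.eigenvectorBasis rfl i) (h.eigenvectorBasis rfl i) :
        F →ₗ[𝕜] F)
  else 0

theorem opSqrt_apply_basis {T : F →ₗ[𝕜] F} (h : T.IsSymmetric)
    (j : Fin (Module.finrank 𝕜 F)) :
    opSqrt T (h.eigenvectorBasis rfl j) =
      ((√(h.eigenvalues rfl j) : ℝ) : 𝕜) • h.eigenvectorBasis rfl j := by
  classical
  rw [opSqrt, dif_pos h]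
  simp [LinearMap.sum_apply, (h.eigenvectorBasis rfl).inner_eq_ite]

/-- The operator `opSqrt T` is a square root of `T`. -/
theorem opSqrt_mul_self {T : F →ₗ[𝕜] F} (h : T.IsPositive) : opSqrt T ∘ₗ opSqrt T = T := by
  refine (h.isSymmetric.eigenvectorBasis rfl).toBasis.ext fun j => ?_
  have h0 : 0 ≤ h.isSymmetric.eigenvalues rfl j := h.nonneg_eigenvalues rfl j
  simp only [OrthonormalBasis.coe_toBasis, LinearMap.comp_apply, opSqrt_apply_basis, map_smul,
    smul_smul, LinearMap.IsSymmetric.apply_eigenvectorBasis]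
  rw [← RCLike.ofReal_mul, Real.mul_self_sqrt h0]

/-- The operator `opSqrt T` is nonnegative. -/
theorem opSqrt_isPositive (T : F →ₗ[𝕜] F) : (opSqrt T).IsPositive := by
  classical
  rw [opSqrt]
  split_ifs with h
  · refine ⟨?_, ?_⟩
    · intro x y
      simp [LinearMap.sum_apply, sum_inner, inner_sum, inner_smul_left, inner_smul_right]
      refine Finset.sum_congr rfl fun i _ => by ring
    · intro x
      simp only [LinearMap.sum_apply, sum_inner, map_sum, LinearMap.smul_apply, inner_smul_left,
        ContinuousLinearMap.coe_coe, InnerProductSpace.rankOne_apply, RCLike.conj_ofReal]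
      refine Finset.sum_nonneg fun i _ => ?_
      rw [inner_conj_symm, RCLike.re_ofReal_mul, inner_mul_symm_re_eq_norm]
      positivity
  · exact LinearMap.isPositive_zero

/-- `ι* : F → E`, the adjoint of the embedding `ι : E → F` of a subspace. -/
def embAdjoint (E : Submodule 𝕜 F) : F →ₗ[𝕜] E := LinearMap.adjoint E.subtype

end SquareRoot

section Matrices

variable {𝕜 : Type*} [RCLike 𝕜] {n : ℕ}

/-- `E₊`: the subspace spanned by the eigenvectors of `P` to positive eigenvalues.
The subspace `E₋` of `P` is `posSpace (-P)`. -/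
def posSpace (P : Matrix (Fin n) (Fin n) 𝕜) : Submodule 𝕜 (EuclideanSpace 𝕜 (Fin n)) :=
  Submodule.span 𝕜 {v | ∃ lam : ℝ, 0 < lam ∧ P.toEuclideanLin v = (lam : 𝕜) • v}

/-- `P₁⁺ = ι₊* P₁ ι₊ : E₊ → E₊`, with `ι₊ : E₊ → 𝕜ⁿ` the embedding. -/
def posPart (P : Matrix (Fin n) (Fin n) 𝕜) : posSpace P →ₗ[𝕜] posSpace P :=
  embAdjoint (posSpace P) ∘ₗ P.toEuclideanLin ∘ₗ (posSpace P).subtype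

/-- `P₊ = ι₊ ι₊*`, as a matrix. -/
def projPlus (P : Matrix (Fin n) (Fin n) 𝕜) : Matrix (Fin n) (Fin n) 𝕜 :=
  Matrix.toEuclideanLin.symm
    ((posSpace P).subtype ∘ₗ embAdjoint (posSpace P))

/-- `Q₊ = ι₊ (P₁⁺)^(1/2) ι₊*`, as a matrix. -/
def Qplus (P : Matrix (Fin n) (Fin n) 𝕜) : Matrix (Fin n) (Fin n) 𝕜 :=
  Matrix.toEuclideanLin.symm
    ((posSpace P).subtype ∘ₗ opSqrt (𝕜 := 𝕜) (F := posSpace P) (posPart P) ∘ₗ embAdjoint (posSpace P))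

/-- `P₋ = ι₋ ι₋*`, where `E₋` is spanned by the eigenvectors of `P` to negative eigenvalues. -/
def projMinus (P : Matrix (Fin n) (Fin n) 𝕜) : Matrix (Fin n) (Fin n) 𝕜 := projPlus (-P)

/-- `Q₋ = ι₋ (P₁⁻)^(1/2) ι₋*`, where `P₁⁻ = ι₋* (-P₁) ι₋`. -/
def Qminus (P : Matrix (Fin n) (Fin n) 𝕜) : Matrix (Fin n) (Fin n) 𝕜 := Qplus (-P)

end Matrices

section Operator

variable {𝕜 : Type*} [RCLike 𝕜] {n : ℕ}

/-- Lebesgue measure on `[a,b]`. -/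
abbrev intervalMeasure (a b : ℝ) : Measure ℝ := volume.restrict (Set.Icc a b)

/-- The state space `L²([a,b], 𝕜ⁿ)`. -/
abbrev StateSpace (𝕜 : Type*) [RCLike 𝕜] (n : ℕ) (a b : ℝ) : Type _ :=
  Lp (EuclideanSpace 𝕜 (Fin n)) 2 (intervalMeasure a b)

/-- `f` is (the absolutely continuous representative of) an element of `H¹([a,b], 𝕜ⁿ)`, with
derivative `g ∈ L²([a,b], 𝕜ⁿ)`. -/
structure IsH1 (a b : ℝ) (f g : ℝ → EuclideanSpace 𝕜 (Fin n)) : Prop where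
  memLp : MemLp g 2 (intervalMeasure a b)
  eq_integral : ∀ ξ ∈ Set.Icc a b, f ξ = f a + ∫ t in a..ξ, g t

/-- `W [f(b); f(a)]`. -/
def boundaryValue (W : Matrix (Fin n) (Fin n ⊕ Fin n) 𝕜) (a b : ℝ)
    (f : ℝ → EuclideanSpace 𝕜 (Fin n)) : Fin n → 𝕜 :=
  W *ᵥ Sum.elim (f b) (f a)

variable (P₁ : Matrix (Fin n) (Fin n) 𝕜) (P₀ : ℝ → Matrix (Fin n) (Fin n) 𝕜)
  (W : Matrix (Fin n) (Fin n ⊕ Fin n) 𝕜) (a b : ℝ)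

theorem IsH1.intervalIntegrable {a b : ℝ} {f g : ℝ → EuclideanSpace 𝕜 (Fin n)}
    (h : IsH1 a b f g) : IntegrableOn g (Set.Icc a b) :=
  h.memLp.integrable (by norm_num)

theorem IsH1.add {a b : ℝ} {f g f' g' : ℝ → EuclideanSpace 𝕜 (Fin n)}
    (h : IsH1 a b f g) (h' : IsH1 a b f' g') : IsH1 a b (f + f') (g + g') := by
  refine ⟨h.memLp.add h'.memLp, fun ξ hξ => ?_⟩
  have i : ∀ {u : ℝ → EuclideanSpace 𝕜 (Fin n)}, IntegrableOn u (Set.Icc a b) →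
      IntervalIntegrable u volume a ξ := fun hu =>
    (intervalIntegrable_iff_integrableOn_Icc_of_le hξ.1).2
      (hu.mono_set (Set.Icc_subset_Icc_right hξ.2))
  simp only [Pi.add_apply]
  rw [intervalIntegral.integral_add (i h.intervalIntegrable) (i h'.intervalIntegrable),
    h.eq_integral ξ hξ, h'.eq_integral ξ hξ]
  abel

theorem IsH1.smul {a b : ℝ} {f g : ℝ → EuclideanSpace 𝕜 (Fin n)}
    (c : 𝕜) (h : IsH1 a b f g) : IsH1 a b (c • f) (c • g) := by
  refine ⟨h.memLp.const_smul c, fun ξ hξ => ?_⟩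
  simp only [Pi.smul_apply]
  rw [intervalIntegral.integral_smul, h.eq_integral ξ hξ, smul_add]

/-- The graph of the operator `P₁ ∂_ξ + P₀` with boundary condition `W [x(b); x(a)] = 0`: pairs
`(x, y)` of elements of `L²([a,b], 𝕜ⁿ)` such that `x ∈ H¹`, `W [x(b); x(a)] = 0` and
`y = P₁ x' + P₀ x`. -/
def opGraph : Submodule 𝕜 (StateSpace 𝕜 n a b × StateSpace 𝕜 n a b) where
  carrier := {p | ∃ f g : ℝ → EuclideanSpace 𝕜 (Fin n),
    IsH1 a b f g ∧ p.1 =ᵐ[intervalMeasure a b] f ∧ boundaryValue W a b f = 0 ∧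
    p.2 =ᵐ[intervalMeasure a b]
      fun ξ => P₁.toEuclideanLin (g ξ) + (P₀ ξ).toEuclideanLin (f ξ)}
  zero_mem' := by
    refine ⟨0, 0, ⟨MemLp.zero', by simp⟩, Lp.coeFn_zero _ _ _, ?_, ?_⟩
    · have : Sum.elim ((0 : ℝ → EuclideanSpace 𝕜 (Fin n)) b)
          ((0 : ℝ → EuclideanSpace 𝕜 (Fin n)) a) = (0 : Fin n ⊕ Fin n → 𝕜) := by
        ext i; cases i <;> rfl
      rw [boundaryValue, this, Matrix.mulVec_zero]
    · filter_upwards [Lp.coeFn_zero (EuclideanSpace 𝕜 (Fin n)) 2 (intervalMeasure a b)] with ξ h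
      simpa using h
  add_mem' := by
    rintro ⟨x, y⟩ ⟨x', y'⟩ ⟨f, g, h, hx, hW, hy⟩ ⟨f', g', h', hx', hW', hy'⟩
    refine ⟨f + f', g + g', h.add h', (Lp.coeFn_add x x').trans (hx.add hx'), ?_, ?_⟩
    · have : (Sum.elim ((f + f') b) ((f + f') a) : Fin n ⊕ Fin n → 𝕜) =
          Sum.elim (f b) (f a) + Sum.elim (f' b) (f' a) := by
        ext i; cases i <;> rfl
      rw [boundaryValue] at hW hW' ⊢
      rw [this, Matrix.mulVec_add, hW, hW', add_zero]
    · filter_upwards [Lp.coeFn_add y y', hy, hy'] with ξ h1 h2 h3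
      change (y + y' : StateSpace 𝕜 n a b) ξ = _
      rw [h1, Pi.add_apply, h2, h3]
      simp only [Pi.add_apply, map_add]
      abel
  smul_mem' := by
    rintro c ⟨x, y⟩ ⟨f, g, h, hx, hW, hy⟩
    refine ⟨c • f, c • g, h.smul c, (Lp.coeFn_smul c x).trans (hx.const_smul c), ?_, ?_⟩
    · have : (Sum.elim ((c • f) b) ((c • f) a) : Fin n ⊕ Fin n → 𝕜) =
          c • Sum.elim (f b) (f a) := by
        ext i; cases i <;> rfl
      rw [boundaryValue] at hW ⊢
      rw [this, Matrix.mulVec_smul, hW, smul_zero]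
    · filter_upwards [Lp.coeFn_smul c y, hy] with ξ h1 h2
      change (c • y : StateSpace 𝕜 n a b) ξ = _
      rw [h1, Pi.smul_apply, h2]
      simp only [Pi.smul_apply, map_smul, smul_add]

/-- The (unbounded) operator `P₁ ∂_ξ + P₀` on `L²([a,b], 𝕜ⁿ)` with domain
`{x ∈ H¹([a,b], 𝕜ⁿ) | W [x(b); x(a)] = 0}`. -/
def opA : StateSpace 𝕜 n a b →ₗ.[𝕜] StateSpace 𝕜 n a b :=
  (opGraph P₁ P₀ W a b).toLinearPMap

variable {a b}

theorem IsH1.continuousOn {f g : ℝ → EuclideanSpace 𝕜 (Fin n)}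
    (h : IsH1 a b f g) : ContinuousOn f (Set.Icc a b) := by
  rcases lt_or_ge b a with hba | hab
  · simp [Set.Icc_eq_empty_of_lt hba]
  have hi := (intervalIntegrable_iff_integrableOn_Icc_of_le hab).2 h.intervalIntegrable
  have hc := intervalIntegral.continuousOn_primitive_interval' hi Set.left_mem_uIcc
  rw [Set.uIcc_of_le hab] at hc
  exact (continuousOn_const.add hc).congr h.eq_integral

/-- The weak derivative is unique, hence `opGraph` is the graph of an operator. -/
theorem opGraph_functional (hab : a < b) (p : StateSpace 𝕜 n a b × StateSpace 𝕜 n a b)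
    (hp : p ∈ opGraph P₁ P₀ W a b) (h0 : p.1 = 0) : p.2 = 0 := by
  obtain ⟨f, g, h, hx, -, hy⟩ := hp
  have hf : ∀ᵐ ξ ∂(intervalMeasure a b), f ξ = 0 := by
    rw [h0] at hx
    filter_upwards [hx, Lp.coeFn_zero (EuclideanSpace 𝕜 (Fin n)) 2 (intervalMeasure a b)]
      with ξ h1 h2
    rw [← h1, h2, Pi.zero_apply]
  have hf0 : Set.EqOn f 0 (Set.Icc a b) :=
    Measure.eqOn_Icc_of_ae_eq volume hab.ne hf h.continuousOn continuousOn_const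
  have hi := (intervalIntegrable_iff_integrableOn_Icc_of_le hab.le).2 h.intervalIntegrable
  have hg : ∀ᵐ ξ ∂(intervalMeasure a b), g ξ = 0 := by
    have hd := hi.ae_hasDerivAt_integral
    rw [intervalMeasure, ← restrict_Ioo_eq_restrict_Icc, ae_restrict_iff' measurableSet_Ioo]
    filter_upwards [hd] with ξ hξ hm
    have h1 := hξ (by rw [Set.uIcc_of_le hab.le]; exact Set.Ioo_subset_Icc_self hm) a
      Set.left_mem_uIcc
    have h2 : (fun x => ∫ t in a..x, g t) =ᶠ[𝓝 ξ] fun _ => 0 := by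
      filter_upwards [Ioo_mem_nhds hm.1 hm.2] with x hx
      have h3 := h.eq_integral x (Set.Ioo_subset_Icc_self hx)
      rw [hf0 (Set.Ioo_subset_Icc_self hx), hf0 (Set.left_mem_Icc.2 hab.le)] at h3
      simpa using h3.symm
    exact h1.unique ((hasDerivAt_const ξ 0).congr_of_eventuallyEq h2)
  refine Lp.ext ?_
  filter_upwards [hy, hf, hg, Lp.coeFn_zero (EuclideanSpace 𝕜 (Fin n)) 2 (intervalMeasure a b)]
    with ξ h1 h2 h3 h4
  rw [h1, h2, h3, h4]
  simp

theorem opA_graph (hab : a < b) : (opA P₁ P₀ W a b).graph = opGraph P₁ P₀ W a b :=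
  Submodule.toLinearPMap_graph_eq _ fun p hp h0 => opGraph_functional P₁ P₀ W hab p hp h0

/-- For `P₀ ∈ L^∞`, the domain of `opA` is `{x ∈ H¹([a,b], 𝕜ⁿ) | W [x(b); x(a)] = 0}`. -/
theorem mem_opA_domain
    (hP₀ : ∀ i j, MemLp (fun ξ => P₀ ξ i j) ∞ (intervalMeasure a b))
    (x : StateSpace 𝕜 n a b) :
    x ∈ (opA P₁ P₀ W a b).domain ↔ ∃ f g : ℝ → EuclideanSpace 𝕜 (Fin n),
      IsH1 a b f g ∧ x =ᵐ[intervalMeasure a b] f ∧ boundaryValue W a b f = 0 := by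
  constructor
  · rintro ⟨p, ⟨f, g, h, hx, hW, -⟩, rfl⟩
    exact ⟨f, g, h, hx, hW⟩
  · rintro ⟨f, g, h, hx, hW⟩
    have hfm : MemLp f 2 (intervalMeasure a b) := (memLp_congr_ae hx).1 (Lp.memLp x)
    have h1 : MemLp (fun ξ => P₁.toEuclideanLin (g ξ)) 2 (intervalMeasure a b) :=
      (LinearMap.toContinuousLinearMap P₁.toEuclideanLin).comp_memLp' h.memLp
    have h2 : MemLp (fun ξ => (P₀ ξ).toEuclideanLin (f ξ)) 2 (intervalMeasure a b) := by
      refine MemLp.of_eval_piLp fun i => ?_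
      have : (fun ξ => (P₀ ξ).toEuclideanLin (f ξ) i) = fun ξ => ∑ j, P₀ ξ i j * f ξ j := by
        ext ξ; rfl
      rw [this]
      refine memLp_finsetSum _ fun j _ => ?_
      exact (hfm.eval_piLp j).mul (hP₀ i j)
    exact ⟨(x, (h1.add h2).toLp), ⟨f, g, h, hx, hW, (h1.add h2).coeFn_toLp⟩, rfl⟩

end Operator

end HBCS

end

/-!
Since `Q₊ Q₋ = 0` and `Q₊² - Q₋² = P₁`, multiplying `W` by `[Q₊; -Q₋]` and `[Q₋; -Q₊]` isolates
`J P₁` and `L P₁`, and `W [P₊; P₋] = J (Q₊ + Q₋)` with `Q₊ + Q₋` invertible.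

*Sufficiency.* If `J` is invertible, the boundary condition reads
`Q₊ x(b) + Q₋ x(a) = M (Q₋ x(b) + Q₊ x(a))`: the incoming characteristics are given in terms of the
outgoing ones. In an equivalent inner product, weighted exponentially along the two families of
characteristics, the outgoing boundary terms dominate the incoming ones, so that `P₁ ∂ - ω` is
dissipative for some `ω`. The range condition is a linear ODE with boundary conditions, where
injectivity gives surjectivity, and the Lumer–Phillips theorem applies. The bounded operator `P₀` is
a perturbation.

*Necessity.* A vector `u` in the kernel of `W [P₊; P₋]` gives functions in the domain of `A_I`, with
boundary values `P₊ u` at `b` and `P₋ u` at `a`, that concentrate at the boundary and satisfy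
`λ x - P₁ x' → 0` in `L²` as `λ → ∞`. The resolvent estimate of a generator then forces `P₁ x' → 0`,
whereas the integral of `P₁ x'` is `P₁ (P₊ u - P₋ u)`. Hence `P₊ u = P₋ u`, so both vanish and
`u = P₊ u + P₋ u = 0`.
-/

namespace HBCS

section SquareRoot

variable {𝕜 : Type*} [RCLike 𝕜] {F : Type*} [NormedAddCommGroup F] [InnerProductSpace 𝕜 F]
  [FiniteDimensional 𝕜 F]

theorem opSqrt_apply_of_eigenvector {T : F →ₗ[𝕜] F} (h : T.IsSymmetric) {μ : ℝ} {v : F}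
    (hv : T v = (μ : 𝕜) • v) : opSqrt T v = ((√μ : ℝ) : 𝕜) • v := by
  set e := h.eigenvectorBasis rfl with he
  refine InnerProductSpace.ext_inner_left_basis (𝕜 := 𝕜) e.toBasis fun j => ?_
  rw [e.coe_toBasis]
  have h_sqrt : inner 𝕜 (e j) (opSqrt T v) =
      ((√(h.eigenvalues rfl j) : ℝ) : 𝕜) * inner 𝕜 (e j) v := by
    rw [← (opSqrt_isPositive T).isSymmetric, he, opSqrt_apply_basis h, inner_smul_left,
      RCLike.conj_ofReal]
  have h_eigen : ((h.eigenvalues rfl j : ℝ) : 𝕜) * inner 𝕜 (e j) v =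
      (μ : 𝕜) * inner 𝕜 (e j) v := by
    rw [← inner_smul_right (e j) v (μ : 𝕜), ← hv, ← h, he, h.apply_eigenvectorBasis rfl j,
      inner_smul_left, RCLike.conj_ofReal]
  rw [h_sqrt, inner_smul_right]
  rcases mul_eq_mul_right_iff.1 h_eigen with h_eq | h_zero
  · rw [RCLike.ofReal_inj.1 h_eq]
  · simp [h_zero]

theorem embAdjoint_apply_coe (E : Submodule 𝕜 F) (v : E) : embAdjoint E (v : F) = v := by
  refine ext_inner_left 𝕜 fun w => ?_
  rw [embAdjoint, LinearMap.adjoint_inner_right]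
  rfl

theorem embAdjoint_apply_of_mem_orthogonal (E : Submodule 𝕜 F) {v : F} (hv : v ∈ Eᗮ) :
    embAdjoint E v = 0 := by
  refine ext_inner_left 𝕜 fun w => ?_
  rw [embAdjoint, LinearMap.adjoint_inner_right, inner_zero_right]
  exact hv w w.2

end SquareRoot

section SpectralParts

variable {𝕜 : Type*} [RCLike 𝕜] {n : ℕ} {P : Matrix (Fin n) (Fin n) 𝕜}

theorem posPart_isSymmetric (hP : P.IsHermitian) :
    LinearMap.IsSymmetric (𝕜 := 𝕜) (E := posSpace P) (posPart P) := by
  intro x y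
  simp only [posPart, embAdjoint, LinearMap.comp_apply, LinearMap.adjoint_inner_left,
    LinearMap.adjoint_inner_right]
  exact Matrix.isSymmetric_toEuclideanLin_iff.2 hP _ _

theorem mem_posSpace {μ : ℝ} {v : EuclideanSpace 𝕜 (Fin n)}
    (hv : P.toEuclideanLin v = (μ : 𝕜) • v) (hμ : 0 < μ) : v ∈ posSpace P :=
  Submodule.subset_span ⟨μ, hμ, hv⟩

theorem mem_posSpace_orthogonal (hP : P.IsHermitian) {μ : ℝ} {v : EuclideanSpace 𝕜 (Fin n)}
    (hv : P.toEuclideanLin v = (μ : 𝕜) • v) (hμ : μ ≤ 0) : v ∈ (posSpace P)ᗮ := by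
  rw [← Submodule.span_singleton_le_iff_mem, Submodule.le_orthogonal_iff_le_orthogonal, posSpace,
    Submodule.span_le]
  rintro w ⟨lam, hlam, hw⟩
  rw [SetLike.mem_coe, Submodule.mem_orthogonal_singleton_iff_inner_left]
  have h := Matrix.isSymmetric_toEuclideanLin_iff.2 hP w v
  rw [hv, hw, inner_smul_left, inner_smul_right, RCLike.conj_ofReal] at h
  refine (mul_eq_mul_right_iff.1 h).resolve_left fun h_eq => ?_
  exact (hμ.trans_lt hlam).ne' (RCLike.ofReal_inj.1 h_eq)

theorem projPlus_apply_of_eigenvector (hP : P.IsHermitian) {μ : ℝ}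
    {v : EuclideanSpace 𝕜 (Fin n)} (hv : P.toEuclideanLin v = (μ : 𝕜) • v) :
    (projPlus P).toEuclideanLin v = ((if 0 < μ then 1 else 0 : ℝ) : 𝕜) • v := by
  rw [projPlus, LinearEquiv.apply_symm_apply, LinearMap.comp_apply]
  split_ifs with hμ
  · rw [embAdjoint_apply_coe (posSpace P) ⟨v, mem_posSpace hv hμ⟩, RCLike.ofReal_one, one_smul]
    rfl
  · rw [embAdjoint_apply_of_mem_orthogonal _ (mem_posSpace_orthogonal hP hv (not_lt.1 hμ)),
      map_zero, RCLike.ofReal_zero, zero_smul]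

theorem Qplus_apply_of_eigenvector (hP : P.IsHermitian) {μ : ℝ}
    {v : EuclideanSpace 𝕜 (Fin n)} (hv : P.toEuclideanLin v = (μ : 𝕜) • v) :
    (Qplus P).toEuclideanLin v = ((√μ : ℝ) : 𝕜) • v := by
  rw [Qplus, LinearEquiv.apply_symm_apply, LinearMap.comp_apply, LinearMap.comp_apply]
  rcases lt_or_ge 0 μ with hμ | hμ
  · lift v to posSpace P using mem_posSpace hv hμ
    have h_eigen : posPart P v = (μ : 𝕜) • v := by
      rw [posPart, LinearMap.comp_apply, LinearMap.comp_apply, Submodule.subtype_apply, hv,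
        map_smul, embAdjoint_apply_coe]
    have h_sqrt := opSqrt_apply_of_eigenvector (F := posSpace P) (posPart_isSymmetric hP) h_eigen
    rw [embAdjoint_apply_coe]
    exact congrArg Subtype.val h_sqrt
  · rw [embAdjoint_apply_of_mem_orthogonal _ (mem_posSpace_orthogonal hP hv hμ), map_zero,
      map_zero, Real.sqrt_eq_zero'.2 hμ, RCLike.ofReal_zero, zero_smul]

end SpectralParts

section FunctionalCalculus

variable {𝕜 : Type*} [RCLike 𝕜] {n : ℕ} {P : Matrix (Fin n) (Fin n) 𝕜}

theorem toEuclideanLin_eigenvectorBasis (hP : P.IsHermitian) (i : Fin n) :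
    P.toEuclideanLin (hP.eigenvectorBasis i) =
      ((hP.eigenvalues i : ℝ) : 𝕜) • hP.eigenvectorBasis i := by
  rw [Matrix.toLpLin_apply, hP.mulVec_eigenvectorBasis, ← RCLike.real_smul_eq_coe_smul]
  rfl

theorem toEuclideanLin_cfc_eigenvectorBasis (hP : P.IsHermitian) (f : ℝ → ℝ) (i : Fin n) :
    (cfc f P).toEuclideanLin (hP.eigenvectorBasis i) =
      ((f (hP.eigenvalues i) : ℝ) : 𝕜) • hP.eigenvectorBasis i := by
  rw [hP.cfc_eq, Matrix.IsHermitian.cfc, Unitary.conjStarAlgAut_apply, Matrix.toLpLin_apply,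
    ← Matrix.mulVec_mulVec, ← Matrix.mulVec_mulVec, hP.star_eigenvectorUnitary_mulVec]
  simp

theorem eq_cfc_of_eigenvectors (hP : P.IsHermitian) {A : Matrix (Fin n) (Fin n) 𝕜} {f : ℝ → ℝ}
    (h : ∀ (μ : ℝ) (v : EuclideanSpace 𝕜 (Fin n)), P.toEuclideanLin v = (μ : 𝕜) • v →
      A.toEuclideanLin v = ((f μ : ℝ) : 𝕜) • v) : A = cfc f P := by
  refine Matrix.toEuclideanLin.injective (hP.eigenvectorBasis.toBasis.ext fun i => ?_)
  rw [hP.eigenvectorBasis.coe_toBasis, h _ _ (toEuclideanLin_eigenvectorBasis hP i),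
    toEuclideanLin_cfc_eigenvectorBasis]

theorem Qplus_eq_cfc (hP : P.IsHermitian) : Qplus P = cfc Real.sqrt P :=
  eq_cfc_of_eigenvectors hP fun _ _ => Qplus_apply_of_eigenvector hP

theorem projPlus_eq_cfc (hP : P.IsHermitian) :
    projPlus P = cfc (fun x : ℝ => if 0 < x then 1 else 0) P :=
  eq_cfc_of_eigenvectors hP fun _ _ => projPlus_apply_of_eigenvector hP

theorem cfc_mul_cfc {f g h : ℝ → ℝ} (hfg : ∀ x, f x * g x = h x) :
    cfc f P * cfc g P = cfc h P := by
  rw [← cfc_mul f g P (Matrix.finite_real_spectrum.continuousOn f)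
    (Matrix.finite_real_spectrum.continuousOn g)]
  simp only [hfg]

theorem cfc_sub_cfc {f g h : ℝ → ℝ} (hfg : ∀ x, f x - g x = h x) :
    cfc f P - cfc g P = cfc h P := by
  rw [← cfc_sub f g P (Matrix.finite_real_spectrum.continuousOn f)
    (Matrix.finite_real_spectrum.continuousOn g)]
  simp only [hfg]

theorem cfc_neg_arg (hP : P.IsHermitian) (f : ℝ → ℝ) :
    cfc f (-P) = cfc (fun x => f (-x)) P :=
  (cfc_comp_neg f P (((Matrix.finite_real_spectrum (A := P)).image _).continuousOn f)
    hP.isSelfAdjoint).symm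

theorem Qminus_eq_cfc (hP : P.IsHermitian) : Qminus P = cfc (fun x => √(-x)) P := by
  rw [Qminus, Qplus_eq_cfc hP.neg, cfc_neg_arg hP]

theorem projMinus_eq_cfc (hP : P.IsHermitian) :
    projMinus P = cfc (fun x : ℝ => if x < 0 then 1 else 0) P := by
  rw [projMinus, projPlus_eq_cfc hP.neg, cfc_neg_arg hP]
  simp only [Left.neg_pos_iff]

end FunctionalCalculus

section Identities

variable {𝕜 : Type*} [RCLike 𝕜] {n : ℕ} {P : Matrix (Fin n) (Fin n) 𝕜}

theorem Qplus_mul_Qminus (hP : P.IsHermitian) : Qplus P * Qminus P = 0 := by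
  rw [Qplus_eq_cfc hP, Qminus_eq_cfc hP, ← cfc_const_zero ℝ P]
  refine cfc_mul_cfc fun x => ?_
  rcases le_total x 0 with hx | hx
  · rw [Real.sqrt_eq_zero'.2 hx, zero_mul]
  · rw [Real.sqrt_eq_zero'.2 (neg_nonpos.2 hx), mul_zero]

theorem Qminus_mul_Qplus (hP : P.IsHermitian) : Qminus P * Qplus P = 0 := by
  simpa only [Qminus, neg_neg] using Qplus_mul_Qminus hP.neg

theorem Qplus_mul_self_sub_Qminus_mul_self (hP : P.IsHermitian) :
    Qplus P * Qplus P - Qminus P * Qminus P = P := by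
  rw [Qplus_eq_cfc hP, Qminus_eq_cfc hP, cfc_mul_cfc fun _ => rfl, cfc_mul_cfc fun _ => rfl]
  refine (cfc_sub_cfc fun x => ?_).trans (cfc_id' ℝ P hP.isSelfAdjoint)
  rcases le_total x 0 with hx | hx
  · rw [Real.sqrt_eq_zero'.2 hx, Real.mul_self_sqrt (neg_nonneg.2 hx)]
    ring
  · rw [Real.sqrt_eq_zero'.2 (neg_nonpos.2 hx), Real.mul_self_sqrt hx]
    ring

theorem Qplus_commute (hP : P.IsHermitian) : Commute (Qplus P) P := by
  rw [Qplus_eq_cfc hP]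
  exact ((Commute.refl P).cfc_real _)

theorem Qminus_commute (hP : P.IsHermitian) : Commute (Qminus P) P :=
  Commute.neg_right_iff.1 (Qplus_commute hP.neg)

theorem Qplus_mul_projPlus (hP : P.IsHermitian) : Qplus P * projPlus P = Qplus P := by
  rw [Qplus_eq_cfc hP, projPlus_eq_cfc hP]
  refine cfc_mul_cfc fun x => ?_
  split_ifs with hx
  · rw [mul_one]
  · rw [Real.sqrt_eq_zero'.2 (not_lt.1 hx), zero_mul]

theorem Qplus_mul_projMinus (hP : P.IsHermitian) : Qplus P * projMinus P = 0 := by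
  rw [Qplus_eq_cfc hP, projMinus_eq_cfc hP, ← cfc_const_zero ℝ P]
  refine cfc_mul_cfc fun x => ?_
  split_ifs with hx
  · rw [Real.sqrt_eq_zero'.2 hx.le, zero_mul]
  · rw [mul_zero]

theorem Qminus_mul_projPlus (hP : P.IsHermitian) : Qminus P * projPlus P = 0 := by
  simpa only [Qminus, projMinus, neg_neg] using Qplus_mul_projMinus hP.neg

theorem Qminus_mul_projMinus (hP : P.IsHermitian) : Qminus P * projMinus P = Qminus P :=
  Qplus_mul_projPlus hP.neg

theorem projPlus_mul_projPlus (hP : P.IsHermitian) : projPlus P * projPlus P = projPlus P := by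
  rw [projPlus_eq_cfc hP]
  exact cfc_mul_cfc fun x => by split_ifs <;> simp only [mul_one, mul_zero]

theorem projPlus_mul_projMinus (hP : P.IsHermitian) : projPlus P * projMinus P = 0 := by
  rw [projPlus_eq_cfc hP, projMinus_eq_cfc hP, ← cfc_const_zero ℝ P]
  exact cfc_mul_cfc fun x => by grind

theorem projPlus_commute (hP : P.IsHermitian) : Commute (projPlus P) P := by
  rw [projPlus_eq_cfc hP]
  exact ((Commute.refl P).cfc_real _)

theorem projPlus_add_projMinus (hP : P.IsHermitian) (hu : IsUnit P) :
    projPlus P + projMinus P = 1 := by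
  rw [← sub_neg_eq_add, projPlus_eq_cfc hP, projMinus_eq_cfc hP, ← cfc_neg, ← cfc_one ℝ P,
    cfc_sub_cfc fun _ => rfl]
  refine cfc_congr fun x hx => ?_
  have hx0 : x ≠ 0 := by
    rintro rfl
    exact spectrum.zero_notMem ℝ hu hx
  rcases hx0.lt_or_gt with h | h <;> simp [h, h.le.not_gt]

theorem isUnit_Qplus_add_Qminus (hP : P.IsHermitian) (hu : IsUnit P) :
    IsUnit (Qplus P + Qminus P) := by
  have h : (Qplus P + Qminus P) * (Qplus P - Qminus P) = P := by
    rw [add_mul, mul_sub, mul_sub, Qplus_mul_Qminus hP, Qminus_mul_Qplus hP, sub_zero,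
      zero_sub, ← sub_eq_add_neg, Qplus_mul_self_sub_Qminus_mul_self hP]
  exact isUnit_of_mul_isUnit_left (h ▸ hu)

end Identities

section BoundaryMatrix

variable {𝕜 : Type*} [RCLike 𝕜] {n : ℕ} {P : Matrix (Fin n) (Fin n) 𝕜} {m : Type*}

theorem commute_inv {A : Matrix (Fin n) (Fin n) 𝕜} (h : Commute A P) : Commute A P⁻¹ := by
  rw [← Matrix.zpow_neg_one]
  exact Matrix.Commute.zpow_right h (-1)

theorem Qplus_mul_inv_mul_Qminus (hP : P.IsHermitian) : Qplus P * P⁻¹ * Qminus P = 0 := by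
  rw [(commute_inv (Qplus_commute hP)).eq, mul_assoc, Qplus_mul_Qminus hP, mul_zero]

theorem Qminus_mul_inv_mul_Qplus (hP : P.IsHermitian) : Qminus P * P⁻¹ * Qplus P = 0 := by
  rw [(commute_inv (Qminus_commute hP)).eq, mul_assoc, Qminus_mul_Qplus hP, mul_zero]

theorem Qplus_mul_inv_mul_Qplus_sub (hP : P.IsHermitian) (hu : IsUnit P) :
    Qplus P * P⁻¹ * Qplus P - Qminus P * P⁻¹ * Qminus P = 1 := by
  rw [(commute_inv (Qplus_commute hP)).eq, (commute_inv (Qminus_commute hP)).eq, mul_assoc,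
    mul_assoc, ← mul_sub, Qplus_mul_self_sub_Qminus_mul_self hP,
    Matrix.nonsing_inv_mul _ ((Matrix.isUnit_iff_isUnit_det P).1 hu)]

theorem fromRows_mul_inv_mul_fromCols_sub (hP : P.IsHermitian) (hu : IsUnit P) :
    Matrix.fromRows (Qplus P) (-Qminus P) * P⁻¹ * Matrix.fromCols (Qplus P) (Qminus P) -
      Matrix.fromRows (Qminus P) (-Qplus P) * P⁻¹ * Matrix.fromCols (Qminus P) (Qplus P) = 1 := by
  rw [Matrix.fromRows_mul, Matrix.fromRows_mul_fromCols, Matrix.fromRows_mul,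
    Matrix.fromRows_mul_fromCols, ← Matrix.fromBlocks_one]
  simp only [sub_eq_add_neg, Matrix.fromBlocks_neg, Matrix.fromBlocks_add, neg_mul, neg_neg,
    Qplus_mul_inv_mul_Qminus hP, Qminus_mul_inv_mul_Qplus hP, neg_zero, add_zero]
  congr 1
  · rw [← sub_eq_add_neg, Qplus_mul_inv_mul_Qplus_sub hP hu]
  · rw [add_comm, ← sub_eq_add_neg, Qplus_mul_inv_mul_Qplus_sub hP hu]

theorem mul_fromCols_sub_mul_fromCols (A B C D : Matrix (Fin n) (Fin n) 𝕜)
    (J L : Matrix m (Fin n) 𝕜) :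
    J * Matrix.fromCols A B - L * Matrix.fromCols C D =
      Matrix.fromCols (J * A - L * C) (J * B - L * D) := by
  ext i (j | j) <;> simp

theorem fromCols_mul_fromRows_Qplus (hP : P.IsHermitian) (J L : Matrix m (Fin n) 𝕜) :
    Matrix.fromCols (J * Qplus P - L * Qminus P) (J * Qminus P - L * Qplus P) *
      Matrix.fromRows (Qplus P) (-Qminus P) = J * P := by
  conv_rhs => rw [← Qplus_mul_self_sub_Qminus_mul_self hP]
  simp only [Matrix.fromCols_mul_fromRows, Matrix.sub_mul, Matrix.mul_sub, Matrix.mul_neg,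
    Matrix.mul_assoc, Qplus_mul_Qminus hP, Qminus_mul_Qplus hP, Matrix.mul_zero]
  abel

theorem fromCols_mul_fromRows_Qminus (hP : P.IsHermitian) (J L : Matrix m (Fin n) 𝕜) :
    Matrix.fromCols (J * Qplus P - L * Qminus P) (J * Qminus P - L * Qplus P) *
      Matrix.fromRows (Qminus P) (-Qplus P) = L * P := by
  conv_rhs => rw [← Qplus_mul_self_sub_Qminus_mul_self hP]
  simp only [Matrix.fromCols_mul_fromRows, Matrix.sub_mul, Matrix.mul_sub, Matrix.mul_neg,
    Matrix.mul_assoc, Qplus_mul_Qminus hP, Qminus_mul_Qplus hP, Matrix.mul_zero]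
  abel

theorem eq_fromCols_iff (hP : P.IsHermitian) (hu : IsUnit P) {W : Matrix m (Fin n ⊕ Fin n) 𝕜}
    {J L : Matrix m (Fin n) 𝕜} :
    W = Matrix.fromCols (J * Qplus P - L * Qminus P) (J * Qminus P - L * Qplus P) ↔
      J = W * Matrix.fromRows (Qplus P) (-Qminus P) * P⁻¹ ∧
        L = W * Matrix.fromRows (Qminus P) (-Qplus P) * P⁻¹ := by
  refine ⟨fun h => ?_, fun ⟨hJ, hL⟩ => ?_⟩
  · have hd := (Matrix.isUnit_iff_isUnit_det P).1 hu
    rw [h, fromCols_mul_fromRows_Qplus hP, fromCols_mul_fromRows_Qminus hP,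
      Matrix.mul_nonsing_inv_cancel_right _ _ hd, Matrix.mul_nonsing_inv_cancel_right _ _ hd]
    exact ⟨rfl, rfl⟩
  · rw [← mul_fromCols_sub_mul_fromCols, hJ, hL]
    simp only [Matrix.mul_assoc, ← Matrix.mul_sub]
    simp only [← Matrix.mul_assoc, fromRows_mul_inv_mul_fromCols_sub hP hu, Matrix.mul_one]

theorem eq_mul_fromCols_iff (hP : P.IsHermitian) (hu : IsUnit P) {W : Matrix m (Fin n ⊕ Fin n) 𝕜}
    {K : Matrix m (Fin n) 𝕜} {M : Matrix (Fin n) (Fin n) 𝕜} :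
    W = K * Matrix.fromCols (Qplus P - M * Qminus P) (Qminus P - M * Qplus P) ↔
      K = W * Matrix.fromRows (Qplus P) (-Qminus P) * P⁻¹ ∧
        K * M = W * Matrix.fromRows (Qminus P) (-Qplus P) * P⁻¹ := by
  rw [Matrix.mul_fromCols, Matrix.mul_sub, Matrix.mul_sub, ← Matrix.mul_assoc, ← Matrix.mul_assoc,
    eq_fromCols_iff hP hu]

theorem fromCols_mul_fromRows_proj (hP : P.IsHermitian) (J L : Matrix m (Fin n) 𝕜) :
    Matrix.fromCols (J * Qplus P - L * Qminus P) (J * Qminus P - L * Qplus P) *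
      Matrix.fromRows (projPlus P) (projMinus P) = J * (Qplus P + Qminus P) := by
  simp only [Matrix.fromCols_mul_fromRows, Matrix.sub_mul, Matrix.mul_add, Matrix.mul_assoc,
    Qplus_mul_projPlus hP, Qplus_mul_projMinus hP, Qminus_mul_projPlus hP, Qminus_mul_projMinus hP,
    Matrix.mul_zero, sub_zero]

end BoundaryMatrix

section SemigroupEstimates

variable {𝕜 : Type*} [RCLike 𝕜] {X : Type*} [NormedAddCommGroup X] [NormedSpace 𝕜 X]
  {T : ℝ≥0 → X →L[𝕜] X}

theorem IsC0Semigroup.tendsto_nhds_zero (hT : IsC0Semigroup T) (x : X) :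
    Tendsto (fun t : ℝ≥0 => T t x) (𝓝 0) (𝓝 x) := by
  have h_apply : T 0 x = x := by rw [hT.map_zero, ContinuousLinearMap.id_apply]
  have h_Ioi : ContinuousWithinAt (fun t : ℝ≥0 => T t x) (Set.Ioi 0) 0 := by
    simpa only [ContinuousWithinAt, h_apply] using hT.tendsto_zero x
  have h_Ici := continuousWithinAt_Ioi_iff_Ici.1 h_Ioi
  rwa [ContinuousWithinAt, ← bot_eq_zero, Set.Ici_bot, nhdsWithin_univ, bot_eq_zero,
    h_apply] at h_Ici

theorem IsC0Semigroup.exists_norm_le [CompleteSpace X] (hT : IsC0Semigroup T) :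
    ∃ δ : ℝ≥0, 0 < δ ∧ ∃ C : ℝ, 0 < C ∧ ∀ t ≤ δ, ‖T t‖ ≤ C := by
  by_contra! h_unbounded
  have h_large (k : ℕ) : ∃ t : ℝ≥0, t ≤ 1 / ((k : ℝ≥0) + 1) ∧ (k : ℝ) + 1 < ‖T t‖ :=
    h_unbounded _ (by positivity) _ (by positivity)
  choose t ht hTt using h_large
  have ht_zero : Tendsto t atTop (𝓝 0) :=
    tendsto_of_tendsto_of_tendsto_of_le_of_le tendsto_const_nhds
      tendsto_one_div_add_atTop_nhds_zero_nat (fun _ => zero_le) ht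
  obtain ⟨C, hC⟩ := banach_steinhaus (g := fun k => T (t k)) fun x => by
    obtain ⟨C, hC⟩ := ((hT.tendsto_nhds_zero x).comp ht_zero).norm.bddAbove_range
    exact ⟨C, fun k => hC ⟨k, rfl⟩⟩
  obtain ⟨k, hk⟩ := exists_nat_gt C
  linarith [hTt k, hC k]

theorem IsC0Semigroup.norm_sub_le (hT : IsC0Semigroup T) {C : ℝ} {s t : ℝ≥0} (hs : ‖T s‖ ≤ C)
    (hst : s ≤ t) (x : X) : ‖T t x - T s x‖ ≤ C * ‖T (t - s) x - x‖ := by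
  have h_eq : T t x - T s x = T s (T (t - s) x - x) := by
    rw [map_sub, ← ContinuousLinearMap.comp_apply, ← hT.map_add, add_tsub_cancel_of_le hst]
  rw [h_eq]
  exact (T s).le_of_opNorm_le hs _

theorem IsC0Semigroup.continuousOn_orbit (hT : IsC0Semigroup T) {δ : ℝ≥0} {C : ℝ}
    (hC : ∀ t ≤ δ, ‖T t‖ ≤ C) (x : X) : ContinuousOn (fun t : ℝ≥0 => T t x) (Set.Iic δ) := by
  intro s hs
  rw [ContinuousWithinAt, tendsto_iff_norm_sub_tendsto_zero]
  have h_dist : Tendsto (fun t => nndist t s) (𝓝[Set.Iic δ] s) (𝓝 0) := by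
    rw [← nndist_self s]
    exact (continuous_id.nndist continuous_const).continuousWithinAt
  have h_bound := ((((hT.tendsto_nhds_zero x).comp h_dist).sub_const x).norm).const_mul C
  rw [sub_self, norm_zero, mul_zero] at h_bound
  refine squeeze_zero' (.of_forall fun _ => norm_nonneg _) ?_ h_bound
  filter_upwards [self_mem_nhdsWithin] with t ht
  rcases le_total s t with h | h
  · have h_nndist : nndist t s = t - s := by
      rw [NNReal.nndist_eq, tsub_eq_zero_of_le h, max_eq_left zero_le]
    rw [Function.comp_apply, h_nndist]
    exact hT.norm_sub_le (hC s hs) h x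
  · have h_nndist : nndist t s = s - t := by
      rw [NNReal.nndist_eq, tsub_eq_zero_of_le h, max_eq_right zero_le]
    rw [Function.comp_apply, h_nndist, norm_sub_rev]
    exact hT.norm_sub_le (hC t ht) h x

variable [NormedSpace ℝ X] [IsScalarTower ℝ 𝕜 X]

theorem IsC0Semigroup.hasDerivWithinAt_orbit (hT : IsC0Semigroup T) {x y : X}
    (hxy : Tendsto (fun t : ℝ≥0 => ((t : ℝ) : 𝕜)⁻¹ • (T t x - x)) (𝓝[>] 0) (𝓝 y))
    {t : ℝ} (ht : 0 ≤ t) :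
    HasDerivWithinAt (fun s : ℝ => T s.toNNReal x) (T t.toNNReal y) (Set.Ici t) t := by
  rw [← hasDerivWithinAt_Ioi_iff_Ici, hasDerivWithinAt_iff_tendsto_slope' (by simp)]
  have h_shift : Tendsto (fun s : ℝ => (s - t).toNNReal) (𝓝[>] t) (𝓝[>] 0) := by
    refine tendsto_nhdsWithin_iff.2 ⟨?_, ?_⟩
    · refine Tendsto.mono_left ?_ nhdsWithin_le_nhds
      exact (by fun_prop : Continuous fun s : ℝ => (s - t).toNNReal).tendsto' t 0 (by simp)
    · filter_upwards [self_mem_nhdsWithin] with s hs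
      simpa using hs
  refine (((T t.toNNReal).continuous.tendsto y).comp (hxy.comp h_shift)).congr' ?_
  filter_upwards [self_mem_nhdsWithin] with s hs
  have hs' : 0 ≤ s - t := sub_nonneg.2 (le_of_lt hs)
  have h_split : s.toNNReal = t.toNNReal + (s - t).toNNReal := by
    rw [← Real.toNNReal_add ht hs', add_sub_cancel]
  rw [slope_def_module, h_split, hT.map_add, Function.comp_apply, Function.comp_apply,
    Real.coe_toNNReal _ hs', map_smul, map_sub, ← RCLike.ofReal_inv, ← RCLike.real_smul_eq_coe_smul,
    ContinuousLinearMap.comp_apply]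

theorem hasDerivAt_exp_neg_mul (lam t : ℝ) :
    HasDerivAt (fun t : ℝ => Real.exp (-(lam * t))) (Real.exp (-(lam * t)) * (-lam)) t :=
  ((hasDerivAt_id t).const_mul lam).fun_neg.exp.congr_deriv (by rw [mul_one, id])

/-- The function `t ↦ e^{-λt} T(t) x` has right derivative `-e^{-λt} T(t) (λx - Ax)`, so its
increment on `[0, δ]` is at most `C ‖λx - Ax‖ / λ`. -/
theorem IsC0Semigroup.norm_exp_smul_orbit_sub_le (hT : IsC0Semigroup T) {δ : ℝ≥0} {C : ℝ}
    (hC : ∀ t ≤ δ, ‖T t‖ ≤ C) {lam : ℝ} (hlam : 0 < lam) {x y : X}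
    (hxy : Tendsto (fun t : ℝ≥0 => ((t : ℝ) : 𝕜)⁻¹ • (T t x - x)) (𝓝[>] 0) (𝓝 y)) :
    ‖Real.exp (-(lam * δ)) • T δ x - x‖ ≤ C * ‖(lam : 𝕜) • x - y‖ / lam := by
  have hC_nonneg : 0 ≤ C := (norm_nonneg _).trans (hC δ le_rfl)
  have h_cont : ContinuousOn (fun t : ℝ => Real.exp (-(lam * t)) • T t.toNNReal x - x)
      (Set.Icc 0 (δ : ℝ)) := by
    refine ContinuousOn.sub (ContinuousOn.smul (by fun_prop) ?_) continuousOn_const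
    refine (hT.continuousOn_orbit hC x).comp continuous_real_toNNReal.continuousOn fun t ht => ?_
    exact Real.toNNReal_le_iff_le_coe.2 ht.2
  have h_deriv (t : ℝ) (ht : t ∈ Set.Ico 0 (δ : ℝ)) : HasDerivWithinAt
      (fun t : ℝ => Real.exp (-(lam * t)) • T t.toNNReal x - x)
      (Real.exp (-(lam * t)) • T t.toNNReal (y - (lam : 𝕜) • x)) (Set.Ici t) t := by
    refine (((hasDerivAt_exp_neg_mul lam t).hasDerivWithinAt.fun_smul
      (hT.hasDerivWithinAt_orbit hxy ht.1)).sub_const x).congr_deriv ?_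
    rw [map_sub, map_smul, ← RCLike.real_smul_eq_coe_smul (K := 𝕜)]
    module
  have h_boundary (t : ℝ) : HasDerivAt
      (fun t : ℝ => C * ‖(lam : 𝕜) • x - y‖ / lam * (1 - Real.exp (-(lam * t))))
      (C * ‖(lam : 𝕜) • x - y‖ * Real.exp (-(lam * t))) t := by
    refine (((hasDerivAt_exp_neg_mul lam t).const_sub 1).const_mul _).congr_deriv ?_
    field_simp
  have h_increment := image_norm_le_of_norm_deriv_right_le_deriv_boundary h_cont h_deriv
    (by simp [hT.map_zero]) h_boundary (fun t ht => by
      rw [norm_smul, Real.norm_of_nonneg (Real.exp_pos _).le, mul_comm, norm_sub_rev _ y]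
      gcongr
      exact (T t.toNNReal).le_of_opNorm_le (hC _ (Real.toNNReal_le_iff_le_coe.2 ht.2.le)) _)
    (Set.right_mem_Icc.2 δ.2)
  rw [Real.toNNReal_coe] at h_increment
  refine h_increment.trans (mul_le_of_le_one_right (by positivity) ?_)
  linarith [Real.exp_pos (-(lam * δ))]

theorem IsC0Semigroup.exists_resolvent_bound [CompleteSpace X] (hT : IsC0Semigroup T) :
    ∃ C : ℝ, 0 < C ∧ ∀ᶠ lam : ℝ in atTop, ∀ x y : X,
      Tendsto (fun t : ℝ≥0 => ((t : ℝ) : 𝕜)⁻¹ • (T t x - x)) (𝓝[>] 0) (𝓝 y) →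
      lam * ‖x‖ ≤ C * ‖(lam : 𝕜) • x - y‖ := by
  obtain ⟨δ, hδ, C, hC_pos, hC⟩ := hT.exists_norm_le
  have h_decay : Tendsto (fun lam : ℝ => C * Real.exp (-(lam * δ))) atTop (𝓝 0) := by
    simpa using (Real.tendsto_exp_neg_atTop_nhds_zero.comp
      (tendsto_id.atTop_mul_const (NNReal.coe_pos.2 hδ))).const_mul C
  refine ⟨2 * C, by positivity, ?_⟩
  filter_upwards [eventually_gt_atTop 0, h_decay.eventually_lt_const one_half_pos]
    with lam hlam h_small x y hxy
  have h_contract : ‖Real.exp (-(lam * δ)) • T δ x‖ ≤ 1 / 2 * ‖x‖ := by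
    rw [norm_smul, Real.norm_of_nonneg (Real.exp_pos _).le]
    calc _ ≤ Real.exp (-(lam * δ)) * (C * ‖x‖) := by
          gcongr
          exact (T δ).le_of_opNorm_le (hC δ le_rfl) x
      _ = C * Real.exp (-(lam * δ)) * ‖x‖ := by ring
      _ ≤ _ := by gcongr
  have h_increment := hT.norm_exp_smul_orbit_sub_le hC hlam hxy
  have h_triangle := norm_sub_norm_le x (Real.exp (-(lam * δ)) • T δ x)
  rw [norm_sub_rev] at h_triangle
  have h_norm : ‖x‖ ≤ 2 * (C * ‖(lam : 𝕜) • x - y‖ / lam) := by linarith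
  calc lam * ‖x‖ ≤ lam * (2 * (C * ‖(lam : 𝕜) • x - y‖ / lam)) := by gcongr
    _ = 2 * C * ‖(lam : 𝕜) • x - y‖ := by field_simp

end SemigroupEstimates

section Exponential

variable {𝕜 : Type*} [RCLike 𝕜]

theorem norm_exp_smul_le {𝔸 : Type*} [NormedRing 𝔸] [NormedAlgebra 𝕜 𝔸] [CompleteSpace 𝔸]
    {R : 𝔸} {M r : ℝ} (hR : ∀ k : ℕ, ‖R ^ k‖ ≤ M * r ^ k) {s : ℝ} (hs : 0 ≤ s) :
    ‖NormedSpace.exp ((s : 𝕜) • R)‖ ≤ M * Real.exp (s * r) := by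
  have h_real : HasSum (fun k : ℕ => (k.factorial : ℝ)⁻¹ * (s * r) ^ k) (Real.exp (s * r)) := by
    rw [Real.exp_eq_exp_ℝ]
    exact NormedSpace.exp_series_hasSum_exp' (𝕂 := ℝ) (s * r)
  refine (NormedSpace.exp_series_hasSum_exp' (𝕂 := 𝕜) ((s : 𝕜) • R)).norm_le_of_bounded
    (h_real.mul_left M) fun k => ?_
  rw [smul_pow, norm_smul, norm_smul, norm_inv, RCLike.norm_natCast, norm_pow, RCLike.norm_ofReal,
    abs_of_nonneg hs, mul_pow]
  calc (k.factorial : ℝ)⁻¹ * (s ^ k * ‖R ^ k‖) ≤ (k.factorial : ℝ)⁻¹ * (s ^ k * (M * r ^ k)) := by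
        gcongr
        exact hR k
    _ = _ := by ring

variable {X : Type*} [NormedAddCommGroup X] [NormedSpace 𝕜 X]

/-- The one-parameter group `t ↦ exp (t G)` generated by a bounded operator `G`. -/
noncomputable def expOp (G : X →L[𝕜] X) (t : ℝ) : X →L[𝕜] X := NormedSpace.exp ((t : 𝕜) • G)

theorem expOp_zero (G : X →L[𝕜] X) : expOp G 0 = 1 := by
  rw [expOp, RCLike.ofReal_zero, zero_smul, NormedSpace.exp_zero]

theorem commute_expOp {G H : X →L[𝕜] X} (h : Commute G H) (t : ℝ) : Commute (expOp G t) H :=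
  (h.smul_left _).exp_left

theorem expOp_smul_one (c t : ℝ) :
    expOp ((c : 𝕜) • (1 : X →L[𝕜] X)) t = ((Real.exp (t * c) : ℝ) : 𝕜) • 1 := by
  rw [expOp, smul_smul, ← RCLike.ofReal_mul, ← Algebra.algebraMap_eq_smul_one,
    ← Algebra.algebraMap_eq_smul_one, ← NormedSpace.algebraMap_exp_comm, Real.exp_eq_exp_ℝ]
  exact congrArg _ (NormedSpace.algebraMap_exp_comm (𝕂 := ℝ) (𝔸 := 𝕜) (t * c)).symm

variable [CompleteSpace X]

theorem expOp_add_of_commute {G H : X →L[𝕜] X} (h : Commute G H) (t : ℝ) :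
    expOp (G + H) t = expOp G t * expOp H t := by
  let _ : NormedAlgebra ℚ (X →L[𝕜] X) := NormedAlgebra.restrictScalars ℚ 𝕜 _
  rw [expOp, smul_add]
  exact NormedSpace.exp_add_of_commute ((h.smul_left _).smul_right _)

theorem expOp_add (G : X →L[𝕜] X) (s t : ℝ) : expOp G (s + t) = expOp G s * expOp G t := by
  let _ : NormedAlgebra ℚ (X →L[𝕜] X) := NormedAlgebra.restrictScalars ℚ 𝕜 _
  rw [expOp, RCLike.ofReal_add, add_smul]
  exact NormedSpace.exp_add_of_commute (((Commute.refl G).smul_left _).smul_right _)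

/-- The estimate behind the Yosida approximation `c² R - c` of an operator with resolvent `R`. -/
theorem norm_expOp_smul_sub_smul_one_le {R : X →L[𝕜] X} {M r c : ℝ}
    (hR : ∀ k : ℕ, ‖R ^ k‖ ≤ M * r ^ k) {t : ℝ} (ht : 0 ≤ t) :
    ‖expOp (((c ^ 2 : ℝ) : 𝕜) • R - (c : 𝕜) • (1 : X →L[𝕜] X)) t‖ ≤
      M * Real.exp (t * (c ^ 2 * r - c)) := by
  have h_commute : Commute (((c ^ 2 : ℝ) : 𝕜) • R) (((-c : ℝ) : 𝕜) • (1 : X →L[𝕜] X)) :=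
    (Commute.one_right _).smul_right _
  rw [sub_eq_add_neg, ← neg_smul, ← RCLike.ofReal_neg, expOp_add_of_commute h_commute,
    expOp_smul_one, mul_smul_comm, mul_one, norm_smul, RCLike.norm_ofReal, Real.abs_exp, expOp,
    smul_smul, ← RCLike.ofReal_mul]
  calc _ ≤ Real.exp (t * -c) * (M * Real.exp (t * c ^ 2 * r)) := by
        gcongr
        exact norm_exp_smul_le hR (by positivity)
    _ = M * Real.exp (t * (c ^ 2 * r - c)) := by
        rw [mul_left_comm, ← Real.exp_add]
        ring_nf

variable [NormedSpace ℝ X] [IsScalarTower ℝ 𝕜 X]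

theorem hasDerivAt_expOp (G : X →L[𝕜] X) (t : ℝ) : HasDerivAt (expOp G) (expOp G t * G) t := by
  have h_ofReal : HasDerivAt (fun s : ℝ => (s : 𝕜)) 1 t := by
    simpa using (RCLike.ofRealCLM (K := 𝕜)).hasDerivAt (x := t)
  exact ((hasDerivAt_exp_smul_const G (t : 𝕜)).scomp t h_ofReal).congr_deriv (one_smul _ _)

theorem hasDerivAt_expOp_apply (G : X →L[𝕜] X) (x : X) (t : ℝ) :
    HasDerivAt (fun s => expOp G s x) (expOp G t (G x)) t :=
  ((ContinuousLinearMap.apply 𝕜 X x).restrictScalars ℝ).hasFDerivAt.comp_hasDerivAt t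
    (hasDerivAt_expOp G t)

theorem continuous_expOp (G : X →L[𝕜] X) : Continuous (expOp G) :=
  continuous_iff_continuousAt.2 fun t => (hasDerivAt_expOp G t).continuousAt

theorem norm_expOp_sub_expOp_le {G H : X →L[𝕜] X} (hGH : Commute G H) {M w : ℝ}
    (hG : ∀ t, 0 ≤ t → ‖expOp G t‖ ≤ M * Real.exp (w * t))
    (hH : ∀ t, 0 ≤ t → ‖expOp H t‖ ≤ M * Real.exp (w * t)) {t : ℝ} (ht : 0 ≤ t) (x : X) :
    ‖expOp G t x - expOp H t x‖ ≤ M ^ 2 * Real.exp (w * t) * ‖G x - H x‖ * t := by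
  have hM : 0 ≤ M := by simpa using (norm_nonneg _).trans (hG 0 le_rfl)
  have h_interpolate (s : ℝ) :
      expOp H t * expOp (G - H) s = expOp H (t - s) * expOp G s := by
    conv_lhs => rw [← sub_add_cancel t s, expOp_add, mul_assoc,
      ← expOp_add_of_commute (hGH.symm.sub_right (Commute.refl H)), add_sub_cancel]
  have h_deriv (s : ℝ) : HasDerivAt (fun s => expOp H t (expOp (G - H) s x))
      (expOp H t (expOp (G - H) s ((G - H) x))) s :=
    ((expOp H t).restrictScalars ℝ).hasFDerivAt.comp_hasDerivAt s
      (hasDerivAt_expOp_apply (G - H) x s)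
  have h_bound (s : ℝ) (hs : s ∈ Set.Ico 0 t) : ‖expOp H t (expOp (G - H) s ((G - H) x))‖ ≤
      M ^ 2 * Real.exp (w * t) * ‖G x - H x‖ := by
    rw [← mul_apply_eq_comp, h_interpolate, mul_apply_eq_comp]
    calc _ ≤ M * Real.exp (w * (t - s)) * (M * Real.exp (w * s) * ‖(G - H) x‖) := by
          refine ((expOp H (t - s)).le_of_opNorm_le (hH _ (sub_nonneg.2 hs.2.le)) _).trans ?_
          gcongr
          exact (expOp G s).le_of_opNorm_le (hG _ hs.1) _
      _ = M ^ 2 * (Real.exp (w * (t - s)) * Real.exp (w * s)) * ‖(G - H) x‖ := by ring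
      _ = M ^ 2 * Real.exp (w * t) * ‖G x - H x‖ := by
          rw [← Real.exp_add, ← mul_add, sub_add_cancel, sub_apply]
  have h_segment := norm_image_sub_le_of_norm_deriv_le_segment'
    (fun s _ => (h_deriv s).hasDerivWithinAt) h_bound t (Set.right_mem_Icc.2 ht)
  rwa [← mul_apply_eq_comp, h_interpolate, sub_self, expOp_zero, one_mul, expOp_zero,
    one_apply_eq_self, sub_zero] at h_segment

end Exponential

section StrongConvergence

variable {𝕜 : Type*} [RCLike 𝕜] {X : Type*} [NormedAddCommGroup X] [NormedSpace 𝕜 X]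
  {ι : Type*} {l : Filter ι} {Φ : ι → X →L[𝕜] X} {C : ℝ}

theorem tendsto_apply_zero (hC : ∀ᶠ i in l, ‖Φ i‖ ≤ C) {u : ι → X} (hu : Tendsto u l (𝓝 0)) :
    Tendsto (fun i => Φ i (u i)) l (𝓝 0) := by
  have h_bound : Tendsto (fun i => C * ‖u i‖) l (𝓝 0) := by simpa using hu.norm.const_mul C
  refine squeeze_zero_norm' ?_ h_bound
  filter_upwards [hC] with i hi
  exact (Φ i).le_of_opNorm_le hi _

theorem tendsto_apply_of_tendsto (hC : ∀ᶠ i in l, ‖Φ i‖ ≤ C) {u : ι → X} {x y : X}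
    (hu : Tendsto u l (𝓝 x)) (hx : Tendsto (fun i => Φ i x) l (𝓝 y)) :
    Tendsto (fun i => Φ i (u i)) l (𝓝 y) := by
  simpa using (tendsto_apply_zero hC (tendsto_sub_nhds_zero_iff.2 hu)).add hx

theorem tendsto_apply_zero_of_dense (hC : ∀ᶠ i in l, ‖Φ i‖ ≤ C) {D : Set X} (hD : Dense D)
    (h : ∀ x ∈ D, Tendsto (fun i => Φ i x) l (𝓝 0)) (x : X) :
    Tendsto (fun i => Φ i x) l (𝓝 0) := by
  rw [Metric.tendsto_nhds]
  intro ε hε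
  obtain ⟨y, hy, hxy⟩ := hD.exists_dist_lt x (ε := ε / (2 * (|C| + 1))) (by positivity)
  filter_upwards [hC, Metric.tendsto_nhds.1 (h y hy) (ε / 2) (by positivity)] with i hi hiy
  rw [dist_zero_right] at hiy ⊢
  rw [dist_eq_norm] at hxy
  have h_norm : ‖Φ i‖ ≤ |C| + 1 := hi.trans (by linarith [le_abs_self C])
  calc ‖Φ i x‖ = ‖Φ i (x - y) + Φ i y‖ := by rw [← map_add, sub_add_cancel]
    _ ≤ (|C| + 1) * ‖x - y‖ + ‖Φ i y‖ :=
        (norm_add_le _ _).trans (by gcongr; exact (Φ i).le_of_opNorm_le h_norm _)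
    _ < (|C| + 1) * (ε / (2 * (|C| + 1))) + ε / 2 := by gcongr
    _ = ε := by field_simp; norm_num

theorem tendsto_apply_of_dense (hC : ∀ᶠ i in l, ‖Φ i‖ ≤ C) {D : Set X} (hD : Dense D)
    (h : ∀ x ∈ D, Tendsto (fun i => Φ i x) l (𝓝 x)) (x : X) :
    Tendsto (fun i => Φ i x) l (𝓝 x) := by
  refine tendsto_sub_nhds_zero_iff.1 (tendsto_apply_zero_of_dense (Φ := fun i => Φ i - 1)
    (C := C + ‖(1 : X →L[𝕜] X)‖) ?_ hD (fun x hx => tendsto_sub_nhds_zero_iff.2 (h x hx)) x)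
  filter_upwards [hC] with i hi
  exact (norm_sub_le _ _).trans (by gcongr)

end StrongConvergence

section DoubleLimits

theorem tendsto_coe_nhdsGT_zero : Tendsto (fun t : ℝ≥0 => (t : ℝ)) (𝓝[>] 0) (𝓝[>] 0) :=
  tendsto_nhdsWithin_iff.2 ⟨(NNReal.continuous_coe.tendsto 0).mono_left nhdsWithin_le_nhds,
    eventually_mem_nhdsWithin.mono fun _ => NNReal.coe_pos.2⟩

theorem eventually_mem_Icc_and_ge (lam₀ : ℝ) :
    ∀ᶠ p : ℝ × ℝ in 𝓝[≥] 0 ×ˢ atTop, (0 ≤ p.1 ∧ p.1 ≤ 1) ∧ lam₀ ≤ p.2 := by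
  have h_Icc : ∀ᶠ t : ℝ in 𝓝[≥] 0, 0 ≤ t ∧ t ≤ 1 := Icc_mem_nhdsGE one_pos
  exact h_Icc.prod_mk (eventually_ge_atTop lam₀)

variable {X : Type*} [NormedAddCommGroup X] {ι : Type*} {l : Filter ι}

theorem tendsto_of_tendsto_prod [l.NeBot] {k : Filter ℝ} {F : ℝ × ι → X} {G : ℝ → X} {y : X}
    (hF : Tendsto F (k ×ˢ l) (𝓝 y))
    (hG : ∀ᶠ t in k, Tendsto (fun i => F (t, i)) l (𝓝 (G t))) : Tendsto G k (𝓝 y) := by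
  rw [Metric.tendsto_nhds]
  intro ε hε
  filter_upwards [(Metric.tendsto_nhds.1 hF (ε / 2) (by positivity)).curry, hG] with t ht htG
  have h_limit : dist (G t) y ≤ ε / 2 :=
    le_of_tendsto (htG.dist tendsto_const_nhds) (ht.mono fun _ h => h.le)
  linarith

theorem tendsto_inv_smul_sub_of_hasDerivAt [NormedSpace ℝ X] {f f' : ι → ℝ → X} {z : X}
    (hf : ∀ i t, HasDerivAt (f i) (f' i t) t)
    (hf' : Tendsto (fun p : ℝ × ι => f' p.2 p.1) (𝓝[≥] 0 ×ˢ l) (𝓝 z)) :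
    Tendsto (fun p : ℝ × ι => p.1⁻¹ • (f p.2 p.1 - f p.2 0)) (𝓝[>] 0 ×ˢ l) (𝓝 z) := by
  rw [Metric.tendsto_nhds]
  intro ε hε
  obtain ⟨small, h_small, large, h_large, h_close⟩ :=
    eventually_prod_iff.1 (Metric.tendsto_nhds.1 hf' (ε / 2) (by positivity))
  obtain ⟨δ, hδ, h_subset⟩ := mem_nhdsGE_iff_exists_Ico_subset.1 h_small
  have h_Ioo : ∀ᶠ t : ℝ in 𝓝[>] 0, t ∈ Set.Ioo 0 δ := Ioo_mem_nhdsGT hδ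
  filter_upwards [h_Ioo.prod_mk h_large] with ⟨t, i⟩ ⟨⟨ht_pos, ht_lt⟩, hi⟩
  have h_deriv (s : ℝ) : HasDerivAt (fun s => f i s - s • z) (f' i s - z) s := by
    simpa using (hf i s).fun_sub ((hasDerivAt_id s).smul_const z)
  have h_segment := norm_image_sub_le_of_norm_deriv_le_segment' (C := ε / 2)
    (fun s _ => (h_deriv s).hasDerivWithinAt)
    (fun s hs => by
      rw [← dist_eq_norm]
      exact (h_close (h_subset ⟨hs.1, hs.2.trans ht_lt⟩) hi).le) t (Set.right_mem_Icc.2 ht_pos.le)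
  have h_eq : t⁻¹ • (f i t - f i 0) - z = t⁻¹ • (f i t - t • z - (f i 0 - (0 : ℝ) • z)) := by
    rw [zero_smul, sub_zero, sub_right_comm, smul_sub _ _ (t • z), inv_smul_smul₀ ht_pos.ne']
  rw [dist_eq_norm, h_eq, norm_smul, norm_inv, Real.norm_of_nonneg ht_pos.le]
  calc _ ≤ t⁻¹ * (ε / 2 * (t - 0)) := by gcongr
    _ = ε / 2 := by rw [sub_zero]; field_simp
    _ < ε := half_lt_self hε

end DoubleLimits

section Generators

variable {𝕜 : Type*} [RCLike 𝕜] {X : Type*} [NormedAddCommGroup X] [NormedSpace 𝕜 X]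

/-- As `λ` minus the generator is injective for large `λ` and `λ - A` is surjective, the generator
cannot be a proper extension of `A`. -/
theorem IsC0Semigroup.isInfinitesimalGenerator_of_surjective [CompleteSpace X] [NormedSpace ℝ X]
    [IsScalarTower ℝ 𝕜 X] {T : ℝ≥0 → X →L[𝕜] X} (hT : IsC0Semigroup T) {A : X →ₗ.[𝕜] X}
    (hA : ∀ x y, (x, y) ∈ A.graph →
      Tendsto (fun t : ℝ≥0 => ((t : ℝ) : 𝕜)⁻¹ • (T t x - x)) (𝓝[>] 0) (𝓝 y))
    (h_surj : ∀ᶠ lam : ℝ in atTop, ∀ y, ∃ x, (x, (lam : 𝕜) • x - y) ∈ A.graph) :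
    IsInfinitesimalGenerator A T := by
  refine fun x y => ⟨hA x y, fun hxy => ?_⟩
  obtain ⟨C, -, h_bound⟩ := hT.exists_resolvent_bound
  obtain ⟨lam, hlam, h_bound, h_surj⟩ :=
    ((eventually_gt_atTop 0).and (h_bound.and h_surj)).exists
  obtain ⟨x', hx'⟩ := h_surj ((lam : 𝕜) • x - y)
  have h_sub := h_bound (x - x') (y - ((lam : 𝕜) • x' - ((lam : 𝕜) • x - y)))
    ((hxy.sub (hA _ _ hx')).congr fun t => by rw [← smul_sub, map_sub, sub_sub_sub_comm])
  have h_zero : (lam : 𝕜) • (x - x') - (y - ((lam : 𝕜) • x' - ((lam : 𝕜) • x - y))) = 0 := by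
    module
  rw [h_zero, norm_zero, mul_zero] at h_sub
  have h_eq : x = x' :=
    sub_eq_zero.1 (norm_le_zero_iff.1 (nonpos_of_mul_nonpos_right h_sub hlam))
  rwa [← h_eq, sub_sub_cancel] at hx'

end Generators

section HilleYosida

variable {𝕜 : Type*} [RCLike 𝕜] {X : Type*} [NormedAddCommGroup X] [NormedSpace 𝕜 X]

/-- `A` is densely defined and `R` is its resolvent on `[lam₀, ∞)`, with the bounds of the
Hille–Yosida theorem. -/
structure IsHilleYosidaResolvent (A : X →ₗ.[𝕜] X) (R : ℝ → X →L[𝕜] X) (lam₀ ω M : ℝ) : Prop where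
  nonneg : 0 ≤ ω
  le : 2 * ω + 1 ≤ lam₀
  mem_graph : ∀ lam ≥ lam₀, ∀ y, (R lam y, (lam : 𝕜) • R lam y - y) ∈ A.graph
  apply_sub : ∀ lam ≥ lam₀, ∀ x z, (x, z) ∈ A.graph → R lam ((lam : 𝕜) • x - z) = x
  norm_pow_le : ∀ lam ≥ lam₀, ∀ k : ℕ, ‖R lam ^ k‖ ≤ M * ((lam - ω)⁻¹) ^ k
  dense : Dense (A.domain : Set X)

/-- The Yosida approximation `λ² R(λ) - λ = λ A R(λ)` of the operator `A` with resolvent `R`. -/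
noncomputable def yosida (R : ℝ → X →L[𝕜] X) (lam : ℝ) : X →L[𝕜] X :=
  ((lam ^ 2 : ℝ) : 𝕜) • R lam - (lam : 𝕜) • (1 : X →L[𝕜] X)

namespace IsHilleYosidaResolvent

variable {A : X →ₗ.[𝕜] X} {R : ℝ → X →L[𝕜] X} {lam₀ ω M lam mu : ℝ}

theorem const_nonneg (h : IsHilleYosidaResolvent A R lam₀ ω M) : 0 ≤ M := by
  simpa using (norm_nonneg _).trans (h.norm_pow_le lam₀ le_rfl 0)

theorem sub_smul_apply (h : IsHilleYosidaResolvent A R lam₀ ω M) (hlam : lam₀ ≤ lam)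
    (hmu : lam₀ ≤ mu) (y : X) :
    ((lam : 𝕜) - mu) • R lam (R mu y) = R mu y - R lam y := by
  have h_apply := h.apply_sub lam hlam _ _ (h.mem_graph mu hmu y)
  rw [← sub_add, ← sub_smul, map_add, map_smul] at h_apply
  exact eq_sub_of_add_eq h_apply

theorem commute (h : IsHilleYosidaResolvent A R lam₀ ω M) (hlam : lam₀ ≤ lam) (hmu : lam₀ ≤ mu) :
    Commute (R lam) (R mu) := by
  rcases eq_or_ne lam mu with rfl | h_ne
  · exact Commute.refl _
  have h_ne' : (lam : 𝕜) - mu ≠ 0 := sub_ne_zero.2 (RCLike.ofReal_injective.ne h_ne)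
  ext y
  refine smul_right_injective X h_ne' ?_
  change ((lam : 𝕜) - mu) • R lam (R mu y) = ((lam : 𝕜) - mu) • R mu (R lam y)
  rw [h.sub_smul_apply hlam hmu, ← neg_sub (mu : 𝕜) lam, neg_smul, h.sub_smul_apply hmu hlam,
    neg_sub]

theorem commute_yosida (h : IsHilleYosidaResolvent A R lam₀ ω M) (hlam : lam₀ ≤ lam)
    (hmu : lam₀ ≤ mu) : Commute (yosida R lam) (yosida R mu) :=
  ((((h.commute hlam hmu).smul_left _).smul_right _).sub_left
    ((Commute.one_left _).smul_left _)).sub_right ((Commute.one_right _).smul_right _)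

theorem yosida_apply (h : IsHilleYosidaResolvent A R lam₀ ω M) (hlam : lam₀ ≤ lam) {x z : X}
    (hx : (x, z) ∈ A.graph) : yosida R lam x = (lam : 𝕜) • R lam z := by
  have h_apply := h.apply_sub lam hlam x z hx
  rw [map_sub, map_smul, sub_eq_iff_eq_add] at h_apply
  rw [yosida, sub_apply, smul_apply, smul_apply, one_apply_eq_self, pow_two, RCLike.ofReal_mul,
    mul_smul, h_apply, smul_add, add_sub_cancel_left]

theorem norm_smul_le (h : IsHilleYosidaResolvent A R lam₀ ω M) (hlam : lam₀ ≤ lam) :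
    ‖(lam : 𝕜) • R lam‖ ≤ 2 * M := by
  have hM := h.const_nonneg
  have hω := h.nonneg
  have h_le := h.le
  have h_norm := h.norm_pow_le lam hlam 1
  rw [pow_one, pow_one] at h_norm
  have h_ratio : lam * (lam - ω)⁻¹ ≤ 2 := by
    rw [← div_eq_mul_inv, div_le_iff₀ (by linarith)]
    linarith
  rw [norm_smul, RCLike.norm_ofReal, abs_of_pos (by linarith)]
  calc lam * ‖R lam‖ ≤ lam * (M * (lam - ω)⁻¹) := by
        gcongr
        linarith
    _ = lam * (lam - ω)⁻¹ * M := by ring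
    _ ≤ 2 * M := by gcongr

theorem tendsto_resolvent_apply (h : IsHilleYosidaResolvent A R lam₀ ω M) (y : X) :
    Tendsto (fun lam : ℝ => R lam y) atTop (𝓝 0) := by
  have h_inv : Tendsto (fun lam : ℝ => ((lam⁻¹ : ℝ) : 𝕜) • y) atTop (𝓝 0) := by
    simpa using ((RCLike.continuous_ofReal (K := 𝕜)).tendsto 0).comp
      tendsto_inv_atTop_zero |>.smul_const y
  refine (tendsto_apply_zero ((eventually_ge_atTop lam₀).mono fun lam hlam => h.norm_smul_le hlam)
    h_inv).congr' ?_
  filter_upwards [eventually_ne_atTop 0] with lam hlam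
  rw [smul_apply, map_smul, smul_smul, ← RCLike.ofReal_mul, mul_inv_cancel₀ hlam,
    RCLike.ofReal_one, one_smul]

theorem tendsto_smul_resolvent (h : IsHilleYosidaResolvent A R lam₀ ω M) (z : X) :
    Tendsto (fun lam : ℝ => (lam : 𝕜) • R lam z) atTop (𝓝 z) := by
  refine tendsto_apply_of_dense (Φ := fun lam : ℝ => (lam : 𝕜) • R lam)
    ((eventually_ge_atTop lam₀).mono fun lam hlam => h.norm_smul_le hlam) h.dense
    (fun x hx => ?_) z
  obtain ⟨y, hy⟩ := LinearPMap.mem_domain_iff.1 hx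
  have h_add := (h.tendsto_resolvent_apply y).const_add x
  rw [add_zero] at h_add
  refine h_add.congr' ?_
  filter_upwards [eventually_ge_atTop lam₀] with lam hlam
  have h_apply := h.apply_sub lam hlam x y hy
  rw [map_sub, map_smul, sub_eq_iff_eq_add] at h_apply
  exact h_apply.symm

theorem tendsto_yosida (h : IsHilleYosidaResolvent A R lam₀ ω M) {x z : X}
    (hx : (x, z) ∈ A.graph) : Tendsto (fun lam : ℝ => yosida R lam x) atTop (𝓝 z) := by
  refine (h.tendsto_smul_resolvent z).congr' ?_
  filter_upwards [eventually_ge_atTop lam₀] with lam hlam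
  exact (h.yosida_apply hlam hx).symm

variable [CompleteSpace X]

theorem norm_expOp_le (h : IsHilleYosidaResolvent A R lam₀ ω M) (hlam : lam₀ ≤ lam) {t : ℝ}
    (ht : 0 ≤ t) : ‖expOp (yosida R lam) t‖ ≤ M * Real.exp (2 * ω * t) := by
  have hM := h.const_nonneg
  have hω := h.nonneg
  have h_le := h.le
  have h_rate : lam ^ 2 * (lam - ω)⁻¹ - lam ≤ 2 * ω := by
    rw [sub_le_iff_le_add, ← div_eq_mul_inv, div_le_iff₀ (by linarith)]
    nlinarith
  refine (norm_expOp_smul_sub_smul_one_le (h.norm_pow_le lam hlam) ht).trans ?_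
  rw [mul_comm (2 * ω)]
  gcongr

theorem norm_expOp_le_of_le_one (h : IsHilleYosidaResolvent A R lam₀ ω M) (hlam : lam₀ ≤ lam)
    {t : ℝ} (ht : 0 ≤ t) (ht1 : t ≤ 1) : ‖expOp (yosida R lam) t‖ ≤ M * Real.exp (2 * ω) := by
  have hM := h.const_nonneg
  have h_exponent : 2 * ω * t ≤ 2 * ω := mul_le_of_le_one_right (by linarith [h.nonneg]) ht1
  exact (h.norm_expOp_le hlam ht).trans (by gcongr)

theorem eventually_norm_expOp_le (h : IsHilleYosidaResolvent A R lam₀ ω M) :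
    ∀ᶠ p : ℝ × ℝ in 𝓝[≥] 0 ×ˢ atTop, ‖expOp (yosida R p.2) p.1‖ ≤ M * Real.exp (2 * ω) := by
  filter_upwards [eventually_mem_Icc_and_ge lam₀] with p hp
  exact h.norm_expOp_le_of_le_one hp.2 hp.1.1 hp.1.2

variable [NormedSpace ℝ X] [IsScalarTower ℝ 𝕜 X]

theorem tendsto_expOp_sub_expOp (h : IsHilleYosidaResolvent A R lam₀ ω M) {t : ℝ} (ht : 0 ≤ t)
    (x : X) : Tendsto (fun p : ℝ × ℝ => expOp (yosida R p.1) t x - expOp (yosida R p.2) t x)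
      (atTop ×ˢ atTop) (𝓝 0) := by
  have h_large : ∀ᶠ p : ℝ × ℝ in atTop ×ˢ atTop, lam₀ ≤ p.1 ∧ lam₀ ≤ p.2 :=
    (eventually_ge_atTop lam₀).prod_mk (eventually_ge_atTop lam₀)
  refine tendsto_apply_zero_of_dense
    (Φ := fun p : ℝ × ℝ => expOp (yosida R p.1) t - expOp (yosida R p.2) t)
    (C := M * Real.exp (2 * ω * t) + M * Real.exp (2 * ω * t)) ?_ h.dense (fun x hx => ?_) x
  · filter_upwards [h_large] with p hp
    exact (norm_sub_le _ _).trans (add_le_add (h.norm_expOp_le hp.1 ht) (h.norm_expOp_le hp.2 ht))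
  obtain ⟨z, hz⟩ := LinearPMap.mem_domain_iff.1 hx
  have h_yosida := h.tendsto_yosida hz
  have h_bound : Tendsto (fun p : ℝ × ℝ => M ^ 2 * Real.exp (2 * ω * t) *
      ‖yosida R p.1 x - yosida R p.2 x‖ * t) (atTop ×ˢ atTop) (𝓝 0) := by
    simpa using (((h_yosida.comp tendsto_fst).sub (h_yosida.comp tendsto_snd)).norm.const_mul
      (M ^ 2 * Real.exp (2 * ω * t))).mul_const t
  refine squeeze_zero_norm' ?_ h_bound
  filter_upwards [h_large] with p hp
  exact norm_expOp_sub_expOp_le (h.commute_yosida hp.1 hp.2)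
    (fun t ht => h.norm_expOp_le hp.1 ht) (fun t ht => h.norm_expOp_le hp.2 ht) ht x

theorem exists_tendsto_expOp (h : IsHilleYosidaResolvent A R lam₀ ω M) :
    ∃ T : ℝ≥0 → X →L[𝕜] X, ∀ (t : ℝ≥0) (x : X),
      Tendsto (fun lam : ℝ => expOp (yosida R lam) t x) atTop (𝓝 (T t x)) := by
  have h_limit (t : ℝ≥0) (x : X) : ∃ y,
      Tendsto (fun lam : ℝ => expOp (yosida R lam) t x) atTop (𝓝 y) := by
    refine cauchy_map_iff_exists_tendsto.1 (cauchy_map_iff.2 ⟨inferInstance, ?_⟩)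
    rw [uniformity_eq_comap_nhds_zero, tendsto_comap_iff]
    have h_cauchy := (h.tendsto_expOp_sub_expOp t.2 x).neg
    rw [neg_zero] at h_cauchy
    exact h_cauchy.congr fun p => neg_sub _ _
  choose f hf using h_limit
  exact ⟨fun t => continuousLinearMapOfTendsto (fun lam : ℝ => expOp (yosida R lam) (t : ℝ))
    (tendsto_pi_nhds.2 (hf t)), hf⟩

theorem tendsto_expOp_apply (h : IsHilleYosidaResolvent A R lam₀ ω M) (x : X) :
    Tendsto (fun p : ℝ × ℝ => expOp (yosida R p.2) p.1 x) (𝓝[≥] 0 ×ˢ atTop) (𝓝 x) := by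
  refine tendsto_apply_of_dense h.eventually_norm_expOp_le h.dense (fun x hx => ?_) x
  obtain ⟨z, hz⟩ := LinearPMap.mem_domain_iff.1 hx
  have h_bound : Tendsto (fun p : ℝ × ℝ => M * Real.exp (2 * ω) * ‖yosida R p.2 x‖ * p.1)
      (𝓝[≥] 0 ×ˢ atTop) (𝓝 0) := by
    have h_time : Tendsto (fun p : ℝ × ℝ => p.1) (𝓝[≥] 0 ×ˢ atTop) (𝓝 (0 : ℝ)) :=
      tendsto_fst.mono_right nhdsWithin_le_nhds
    simpa using (((h.tendsto_yosida hz).comp tendsto_snd).norm.const_mul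
      (M * Real.exp (2 * ω))).mul h_time
  refine tendsto_sub_nhds_zero_iff.1 (squeeze_zero_norm' ?_ h_bound)
  filter_upwards [eventually_mem_Icc_and_ge lam₀] with p hp
  have h_segment := norm_image_sub_le_of_norm_deriv_le_segment'
    (f := fun s => expOp (yosida R p.2) s x)
    (fun s _ => (hasDerivAt_expOp_apply _ x s).hasDerivWithinAt)
    (fun s hs => (expOp (yosida R p.2) s).le_of_opNorm_le
      (h.norm_expOp_le_of_le_one hp.2 hs.1 (hs.2.le.trans hp.1.2)) _) p.1
    (Set.right_mem_Icc.2 hp.1.1)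
  rwa [expOp_zero, one_apply_eq_self, sub_zero] at h_segment

theorem tendsto_difference_quotient (h : IsHilleYosidaResolvent A R lam₀ ω M) {x z : X}
    (hx : (x, z) ∈ A.graph) :
    Tendsto (fun p : ℝ × ℝ => p.1⁻¹ • (expOp (yosida R p.2) p.1 x - x)) (𝓝[>] 0 ×ˢ atTop)
      (𝓝 z) := by
  have h_deriv := tendsto_apply_of_tendsto h.eventually_norm_expOp_le
    ((h.tendsto_yosida hx).comp tendsto_snd) (h.tendsto_expOp_apply z)
  simpa only [expOp_zero, one_apply_eq_self] using tendsto_inv_smul_sub_of_hasDerivAt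
    (fun lam : ℝ => hasDerivAt_expOp_apply (yosida R lam) x) h_deriv

variable {T : ℝ≥0 → X →L[𝕜] X}

theorem isC0Semigroup (h : IsHilleYosidaResolvent A R lam₀ ω M)
    (hT : ∀ (t : ℝ≥0) (x : X),
      Tendsto (fun lam : ℝ => expOp (yosida R lam) t x) atTop (𝓝 (T t x))) : IsC0Semigroup T where
  map_zero := by
    ext x
    refine tendsto_nhds_unique (hT 0 x) ?_
    simp only [NNReal.coe_zero, expOp_zero, one_apply_eq_self, ContinuousLinearMap.id_apply,
      tendsto_const_nhds]
  map_add s t := by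
    ext x
    refine tendsto_nhds_unique (hT (s + t) x) ?_
    refine (tendsto_apply_of_tendsto ((eventually_ge_atTop lam₀).mono fun lam hlam =>
      h.norm_expOp_le hlam s.2) (hT t x) (hT s (T t x))).congr fun lam => ?_
    rw [NNReal.coe_add, expOp_add]
    rfl
  tendsto_zero x := by
    have h_limit := tendsto_of_tendsto_prod (G := fun t : ℝ => T t.toNNReal x)
      (h.tendsto_expOp_apply x) (by
        filter_upwards [self_mem_nhdsWithin] with t ht
        simpa only [Real.coe_toNNReal t ht] using hT t.toNNReal x)
    simpa only [Function.comp_def, Real.toNNReal_coe] using h_limit.comp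
      (tendsto_coe_nhdsGT_zero.mono_right (nhdsWithin_mono _ Set.Ioi_subset_Ici_self))

theorem tendsto_generator (h : IsHilleYosidaResolvent A R lam₀ ω M)
    (hT : ∀ (t : ℝ≥0) (x : X),
      Tendsto (fun lam : ℝ => expOp (yosida R lam) t x) atTop (𝓝 (T t x))) {x z : X}
    (hx : (x, z) ∈ A.graph) :
    Tendsto (fun t : ℝ≥0 => ((t : ℝ) : 𝕜)⁻¹ • (T t x - x)) (𝓝[>] 0) (𝓝 z) := by
  have h_limit := tendsto_of_tendsto_prod (G := fun t : ℝ => t⁻¹ • (T t.toNNReal x - x))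
    (h.tendsto_difference_quotient hx) (by
      filter_upwards [self_mem_nhdsWithin] with t ht
      simpa only [Real.coe_toNNReal t (le_of_lt ht)] using
        ((hT t.toNNReal x).sub_const x).const_smul t⁻¹)
  refine (h_limit.comp tendsto_coe_nhdsGT_zero).congr fun t => ?_
  rw [Function.comp_apply, Real.toNNReal_coe, RCLike.real_smul_eq_coe_smul (K := 𝕜),
    RCLike.ofReal_inv]

theorem generatesC0Semigroup (h : IsHilleYosidaResolvent A R lam₀ ω M) :
    GeneratesC0Semigroup A := by
  obtain ⟨T, hT⟩ := h.exists_tendsto_expOp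
  refine ⟨T, h.isC0Semigroup hT, (h.isC0Semigroup hT).isInfinitesimalGenerator_of_surjective
    (fun _ _ => h.tendsto_generator hT) ?_⟩
  filter_upwards [eventually_ge_atTop lam₀] with lam hlam y
  exact ⟨R lam y, h.mem_graph lam hlam y⟩

end IsHilleYosidaResolvent

end HilleYosida

section Dissipative

theorem exists_linearMap_resolvent {𝕜 X : Type*} [Field 𝕜] [AddCommGroup X] [Module 𝕜 X]
    {A : X →ₗ.[𝕜] X} {c : 𝕜} (h_inj : ∀ x z, (x, z) ∈ A.graph → c • x - z = 0 → x = 0)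
    (h_surj : ∀ y, ∃ x, (x, c • x - y) ∈ A.graph) :
    ∃ R : X →ₗ[𝕜] X, (∀ y, (R y, c • R y - y) ∈ A.graph) ∧
      ∀ x z, (x, z) ∈ A.graph → R (c • x - z) = x := by
  let φ : A.graph →ₗ[𝕜] X :=
    (c • LinearMap.fst 𝕜 X X - LinearMap.snd 𝕜 X X) ∘ₗ A.graph.subtype
  have h_bijective : Function.Bijective φ := by
    refine ⟨(injective_iff_map_eq_zero φ).2 ?_, fun y => ?_⟩
    · rintro ⟨⟨x, z⟩, hxz⟩ h_zero
      have hx := h_inj x z hxz h_zero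
      exact Subtype.ext (Prod.ext hx (A.graph_fst_eq_zero_snd hxz hx))
    · obtain ⟨x, hx⟩ := h_surj y
      exact ⟨⟨_, hx⟩, sub_sub_cancel _ _⟩
  let e := LinearEquiv.ofBijective φ h_bijective
  refine ⟨LinearMap.fst 𝕜 X X ∘ₗ A.graph.subtype ∘ₗ e.symm, fun y => ?_, fun x z hxz => ?_⟩
  · have h_apply : c • (e.symm y).1.1 - (e.symm y).1.2 = y := e.apply_symm_apply y
    have h_snd : c • (e.symm y).1.1 - y = (e.symm y).1.2 := by
      rw [sub_eq_iff_eq_add, ← sub_eq_iff_eq_add', h_apply]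
    simp only [LinearMap.comp_apply, LinearMap.fst_apply, Submodule.subtype_apply,
      LinearEquiv.coe_coe, h_snd, Prod.mk.eta, SetLike.coe_mem]
  · exact congrArg (fun p : A.graph => p.1.1) (e.symm_apply_apply ⟨(x, z), hxz⟩)

variable {𝕜 : Type*} [RCLike 𝕜] {X : Type*} [NormedAddCommGroup X]

theorem norm_le_of_norm_conj_le [NormedSpace 𝕜 X] (S : X ≃L[𝕜] X) {r : ℝ} (hr : 0 ≤ r) {x y : X}
    (h : ‖S x‖ ≤ r * ‖S y‖) :
    ‖x‖ ≤ ‖(S.symm : X →L[𝕜] X)‖ * ‖(S : X →L[𝕜] X)‖ * r * ‖y‖ := by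
  calc ‖x‖ = ‖(S.symm : X →L[𝕜] X) (S x)‖ := by
        rw [ContinuousLinearEquiv.coe_coe, S.symm_apply_apply]
    _ ≤ ‖(S.symm : X →L[𝕜] X)‖ * (r * (‖(S : X →L[𝕜] X)‖ * ‖y‖)) := by
        refine ((S.symm : X →L[𝕜] X).le_opNorm_of_le h).trans ?_
        gcongr
        exact (S : X →L[𝕜] X).le_opNorm y
    _ = _ := by ring

variable [InnerProductSpace 𝕜 X]

theorem re_inner_apply_self_le (K : X →L[𝕜] X) (x : X) :
    RCLike.re (inner 𝕜 x (K x)) ≤ ‖K‖ * ‖x‖ ^ 2 :=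
  calc RCLike.re (inner 𝕜 x (K x)) ≤ ‖x‖ * (‖K‖ * ‖x‖) :=
        (re_inner_le_norm _ _).trans (by gcongr; exact K.le_opNorm x)
    _ = _ := by ring

theorem sub_mul_norm_le_of_re_inner_le {ω : ℝ} {x z : X}
    (h : RCLike.re (inner 𝕜 x z) ≤ ω * ‖x‖ ^ 2) (lam : ℝ) :
    (lam - ω) * ‖x‖ ≤ ‖(lam : 𝕜) • x - z‖ := by
  rcases (norm_nonneg x).eq_or_lt with h_zero | h_pos
  · rw [← h_zero, mul_zero]
    exact norm_nonneg _
  refine le_of_mul_le_mul_left ?_ h_pos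
  calc ‖x‖ * ((lam - ω) * ‖x‖) = lam * ‖x‖ ^ 2 - ω * ‖x‖ ^ 2 := by ring
    _ ≤ lam * ‖x‖ ^ 2 - RCLike.re (inner 𝕜 x z) := by gcongr
    _ = RCLike.re (inner 𝕜 x ((lam : 𝕜) • x - z)) := by
        rw [inner_sub_right, inner_smul_right, map_sub, RCLike.re_ofReal_mul,
          ← norm_sq_eq_re_inner]
    _ ≤ _ := re_inner_le_norm _ _

theorem eq_zero_of_re_inner_smul_le {ω lam : ℝ} (hlam : ω < lam) {x : X}
    (h : RCLike.re (inner 𝕜 x ((lam : 𝕜) • x)) ≤ ω * ‖x‖ ^ 2) : x = 0 := by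
  have h_norm := sub_mul_norm_le_of_re_inner_le h lam
  rw [sub_self, norm_zero] at h_norm
  exact norm_le_zero_iff.1 (nonpos_of_mul_nonpos_right h_norm (sub_pos.2 hlam))

/-- `A` is quasi-m-dissipative for the equivalent inner product `⟪S x, S y⟫`: the operator `A - ω`
is dissipative, and `λ - A` is surjective for all large real `λ`. -/
structure IsQuasiMDissipative (A : X →ₗ.[𝕜] X) (S : X ≃L[𝕜] X) (ω : ℝ) : Prop where
  nonneg : 0 ≤ ω
  re_inner_le : ∀ x z, (x, z) ∈ A.graph → RCLike.re (inner 𝕜 (S x) (S z)) ≤ ω * ‖S x‖ ^ 2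
  surjective : ∀ᶠ lam : ℝ in atTop, ∀ y, ∃ x, (x, (lam : 𝕜) • x - y) ∈ A.graph

namespace IsQuasiMDissipative

variable {A : X →ₗ.[𝕜] X} {S : X ≃L[𝕜] X} {ω lam : ℝ}

theorem exists_resolvent (h : IsQuasiMDissipative A S ω) (hlam : ω < lam)
    (h_surj : ∀ y, ∃ x, (x, (lam : 𝕜) • x - y) ∈ A.graph) :
    ∃ R : X →L[𝕜] X, (∀ y, (R y, (lam : 𝕜) • R y - y) ∈ A.graph) ∧
      (∀ x z, (x, z) ∈ A.graph → R ((lam : 𝕜) • x - z) = x) ∧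
      ∀ k : ℕ, ‖R ^ k‖ ≤
        ‖(S.symm : X →L[𝕜] X)‖ * ‖(S : X →L[𝕜] X)‖ * ((lam - ω)⁻¹) ^ k := by
  obtain ⟨R, hR_graph, hR_apply⟩ := exists_linearMap_resolvent
    (fun x z hx h_zero => S.map_eq_zero_iff.1 (eq_zero_of_re_inner_smul_le hlam (by
      rw [← map_smul, sub_eq_zero.1 h_zero]
      exact h.re_inner_le x z hx))) h_surj
  have h_pos : 0 < lam - ω := sub_pos.2 hlam
  have h_inv : 0 ≤ (lam - ω)⁻¹ := inv_nonneg.2 h_pos.le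
  have h_norm (y : X) : ‖S (R y)‖ ≤ (lam - ω)⁻¹ * ‖S y‖ := by
    have h_le := sub_mul_norm_le_of_re_inner_le (h.re_inner_le _ _ (hR_graph y)) lam
    rwa [← map_smul, ← map_sub, sub_sub_cancel, ← le_inv_mul_iff₀ h_pos] at h_le
  let R' : X →L[𝕜] X := R.mkContinuous _ fun y => norm_le_of_norm_conj_le S h_inv (h_norm y)
  have h_norm_pow (k : ℕ) (y : X) : ‖S ((R' ^ k) y)‖ ≤ ((lam - ω)⁻¹) ^ k * ‖S y‖ := by
    induction k with
    | zero => rw [pow_zero, pow_zero, one_apply_eq_self, one_mul]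
    | succ k ih =>
      rw [pow_succ', mul_apply_eq_comp, pow_succ', mul_assoc]
      exact (h_norm _).trans (by gcongr)
  exact ⟨R', hR_graph, hR_apply, fun k => ContinuousLinearMap.opNorm_le_bound _ (by positivity)
    fun y => norm_le_of_norm_conj_le S (by positivity) (h_norm_pow k y)⟩

theorem dense_domain [CompleteSpace X] (h : IsQuasiMDissipative A S ω) :
    Dense (A.domain : Set X) := by
  rw [Submodule.dense_iff_topologicalClosure_eq_top, Submodule.topologicalClosure_eq_top_iff,
    Submodule.eq_bot_iff]
  intro w hw
  obtain ⟨lam, hlam, h_surj⟩ := ((eventually_gt_atTop ω).and h.surjective).exists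
  set w' := ContinuousLinearMap.adjoint (S.symm : X →L[𝕜] X) w
  have h_adjoint (v : X) : inner 𝕜 (S v) w' = inner 𝕜 v w := by
    rw [ContinuousLinearMap.adjoint_inner_right, ContinuousLinearEquiv.coe_coe, S.symm_apply_apply]
  obtain ⟨x, hx⟩ := h_surj (S.symm w')
  have h_orthogonal : inner 𝕜 (S x) w' = 0 := by
    rw [h_adjoint]
    exact hw x (LinearPMap.mem_domain_iff.2 ⟨_, hx⟩)
  have h_le := h.re_inner_le _ _ hx
  rw [map_sub, map_smul, S.apply_symm_apply, inner_sub_right, inner_smul_right, h_orthogonal,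
    sub_zero, RCLike.re_ofReal_mul, ← norm_sq_eq_re_inner] at h_le
  have h_norm : ‖S x‖ ^ 2 = 0 := by nlinarith [sq_nonneg ‖S x‖]
  have hx_zero : x = 0 :=
    S.map_eq_zero_iff.1 (norm_eq_zero.1 (pow_eq_zero_iff two_ne_zero |>.1 h_norm))
  rw [hx_zero, smul_zero, zero_sub] at hx
  have hw' : w' = 0 := S.symm.map_eq_zero_iff.1 (neg_eq_zero.1 (A.graph_fst_eq_zero_snd hx rfl))
  rw [← inner_self_eq_zero (𝕜 := 𝕜), ← h_adjoint, hw', inner_zero_right]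

theorem generatesC0Semigroup [CompleteSpace X] [NormedSpace ℝ X] [IsScalarTower ℝ 𝕜 X]
    (h : IsQuasiMDissipative A S ω) : GeneratesC0Semigroup A := by
  obtain ⟨lam₀, h_large⟩ := eventually_atTop.1 (h.surjective.and (eventually_gt_atTop ω))
  choose! R hR_graph hR_apply hR_norm using fun lam (hlam : lam₀ ≤ lam) =>
    h.exists_resolvent (h_large lam hlam).2 (h_large lam hlam).1
  have h_le {lam : ℝ} (hlam : max lam₀ (2 * ω + 1) ≤ lam) : lam₀ ≤ lam :=
    (le_max_left _ _).trans hlam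
  have h_resolvent : IsHilleYosidaResolvent A R (max lam₀ (2 * ω + 1)) ω
      (‖(S.symm : X →L[𝕜] X)‖ * ‖(S : X →L[𝕜] X)‖) :=
    { nonneg := h.nonneg
      le := le_max_right _ _
      mem_graph := fun lam hlam => hR_graph lam (h_le hlam)
      apply_sub := fun lam hlam => hR_apply lam (h_le hlam)
      norm_pow_le := fun lam hlam => hR_norm lam (h_le hlam)
      dense := h.dense_domain }
  exact h_resolvent.generatesC0Semigroup

theorem surjective_add_bounded [CompleteSpace X] (h : IsQuasiMDissipative A S ω) (B : X →L[𝕜] X) :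
    ∀ᶠ lam : ℝ in atTop, ∀ y, ∃ x, (x, (lam : 𝕜) • x - y - B x) ∈ A.graph := by
  set C := ‖B‖ * (‖(S.symm : X →L[𝕜] X)‖ * ‖(S : X →L[𝕜] X)‖)
  filter_upwards [h.surjective, eventually_gt_atTop ω, eventually_gt_atTop (ω + C)]
    with lam h_surj hlam hlam_large y
  obtain ⟨R, hR_graph, -, hR_norm⟩ := h.exists_resolvent hlam h_surj
  have h_small : ‖B * R‖ < 1 := by
    have hR := hR_norm 1
    rw [pow_one, pow_one] at hR
    calc ‖B * R‖ ≤ ‖B‖ * (‖(S.symm : X →L[𝕜] X)‖ * ‖(S : X →L[𝕜] X)‖ * (lam - ω)⁻¹) :=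
          (norm_mul_le _ _).trans (by gcongr)
      _ = C / (lam - ω) := by rw [← mul_assoc, div_eq_mul_inv]
      _ < 1 := by
          rw [div_lt_one (by linarith)]
          linarith
  obtain ⟨G, hG⟩ := isUnit_one_sub_of_norm_lt_one h_small
  have h_solve : (↑G⁻¹ : X →L[𝕜] X) y - B (R ((↑G⁻¹ : X →L[𝕜] X) y)) = y := by
    have h_mul : (G * ↑G⁻¹ : X →L[𝕜] X) y = y := by rw [Units.mul_inv, one_apply_eq_self]
    rwa [hG] at h_mul
  refine ⟨R ((↑G⁻¹ : X →L[𝕜] X) y), ?_⟩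
  convert hR_graph ((↑G⁻¹ : X →L[𝕜] X) y) using 2
  nth_rewrite 2 [← h_solve]
  abel

theorem add_bounded [CompleteSpace X] (h : IsQuasiMDissipative A S ω) (B : X →L[𝕜] X)
    {A' : X →ₗ.[𝕜] X} (hA' : ∀ x z, (x, z) ∈ A'.graph ↔ (x, z - B x) ∈ A.graph) :
    ∃ ω', IsQuasiMDissipative A' S ω' := by
  set K := (S : X →L[𝕜] X) ∘L B ∘L (S.symm : X →L[𝕜] X)
  refine ⟨ω + ‖K‖, add_nonneg h.nonneg (norm_nonneg _), fun x z hx => ?_, ?_⟩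
  · have h_unperturbed := h.re_inner_le x (z - B x) ((hA' x z).1 hx)
    rw [map_sub, inner_sub_right, map_sub] at h_unperturbed
    have h_perturbation : RCLike.re (inner 𝕜 (S x) (S (B x))) ≤ ‖K‖ * ‖S x‖ ^ 2 := by
      simpa [K] using re_inner_apply_self_le K (S x)
    linarith
  · filter_upwards [h.surjective_add_bounded B] with lam h_surj y
    obtain ⟨x, hx⟩ := h_surj y
    exact ⟨x, (hA' _ _).2 hx⟩

end IsQuasiMDissipative

end Dissipative

section ProductRule

variable {E F G : Type*} [NormedAddCommGroup E] [NormedSpace ℝ E]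
  [NormedAddCommGroup F] [NormedSpace ℝ F] [NormedAddCommGroup G] [NormedSpace ℝ G]

theorem intervalIntegrable_bilin_of_continuousOn_right (B : E →L[ℝ] F →L[ℝ] G) {p : ℝ → E}
    {v : ℝ → F} {a c : ℝ} (hac : a ≤ c) (hp : IntegrableOn p (Set.Icc a c))
    (hv : ContinuousOn v (Set.Icc a c)) :
    IntervalIntegrable (fun s => B (p s) (v s)) volume a c := by
  obtain ⟨C, hC⟩ := isCompact_Icc.exists_bound_of_continuousOn hv
  exact (intervalIntegrable_iff_integrableOn_Icc_of_le hac).2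
    (B.integrable_of_bilin_of_bdd_right C hp (hv.aestronglyMeasurable measurableSet_Icc)
      ((ae_restrict_iff' measurableSet_Icc).2 (Eventually.of_forall hC)))

theorem intervalIntegrable_bilin_of_continuousOn_left (B : E →L[ℝ] F →L[ℝ] G) {u : ℝ → E}
    {q : ℝ → F} {a c : ℝ} (hac : a ≤ c) (hu : ContinuousOn u (Set.Icc a c))
    (hq : IntegrableOn q (Set.Icc a c)) :
    IntervalIntegrable (fun s => B (u s) (q s)) volume a c :=
  intervalIntegrable_bilin_of_continuousOn_right B.flip hac hq hu

theorem continuousOn_primitive_Icc {p : ℝ → E} {a c : ℝ} (hac : a ≤ c)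
    (hp : IntegrableOn p (Set.Icc a c)) :
    ContinuousOn (fun s => ∫ r in a..s, p r) (Set.Icc a c) := by
  have h := intervalIntegral.continuousOn_primitive_interval'
    ((intervalIntegrable_iff_integrableOn_Icc_of_le hac).2 hp) Set.left_mem_uIcc
  rwa [Set.uIcc_of_le hac] at h

variable [CompleteSpace E] [CompleteSpace F] [CompleteSpace G]

/-- Fubini's theorem on the two parts `r ≤ s` and `s < r` of the square. -/
theorem bilin_integral_integral_eq_add {α : Type*} [LinearOrder α] [TopologicalSpace α]
    [OrderClosedTopology α] [SecondCountableTopology α] [MeasurableSpace α] [OpensMeasurableSpace α]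
    {μ : Measure α} [SFinite μ] (B : E →L[ℝ] F →L[ℝ] G) {p : α → E} {q : α → F}
    (hp : Integrable p μ) (hq : Integrable q μ) :
    B (∫ s, p s ∂μ) (∫ s, q s ∂μ) =
      ∫ s, B (p s) (∫ r in Set.Iic s, q r ∂μ) ∂μ + ∫ s, B (∫ r in Set.Iio s, p r ∂μ) (q s) ∂μ := by
  have hpq : Integrable (fun z : α × α => B (p z.1) (q z.2)) (μ.prod μ) :=
    hp.op_fst_snd (by fun_prop) ⟨‖B‖, B.le_opNorm₂⟩ hq
  have hD : MeasurableSet {z : α × α | z.2 ≤ z.1} := measurableSet_le measurable_snd measurable_fst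
  have h_le : ∫ z in {z : α × α | z.2 ≤ z.1}, B (p z.1) (q z.2) ∂μ.prod μ =
      ∫ s, B (p s) (∫ r in Set.Iic s, q r ∂μ) ∂μ := by
    rw [← integral_indicator hD, integral_prod _ (hpq.indicator hD)]
    congr 1 with s
    rw [← (B (p s)).integral_comp_comm hq.integrableOn, ← integral_indicator measurableSet_Iic]
    rfl
  have h_gt : ∫ z in {z : α × α | z.2 ≤ z.1}ᶜ, B (p z.1) (q z.2) ∂μ.prod μ =
      ∫ s, B (∫ r in Set.Iio s, p r ∂μ) (q s) ∂μ := by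
    rw [← integral_indicator hD.compl, integral_prod_symm _ (hpq.indicator hD.compl)]
    congr 1 with s
    have h_flip : B (∫ r in Set.Iio s, p r ∂μ) (q s) = ∫ r in Set.Iio s, B (p r) (q s) ∂μ :=
      ((B.flip (q s)).integral_comp_comm hp.integrableOn).symm
    rw [h_flip, ← integral_indicator measurableSet_Iio]
    congr 1 with r
    simp [Set.indicator]
  rw [← integral_prod_bilin B hp hq, ← integral_add_compl hD hpq, h_le, h_gt]

theorem bilin_intervalIntegral_eq_add (B : E →L[ℝ] F →L[ℝ] G) {p : ℝ → E} {q : ℝ → F} {a c : ℝ}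
    (hac : a ≤ c) (hp : IntegrableOn p (Set.Icc a c)) (hq : IntegrableOn q (Set.Icc a c)) :
    B (∫ r in a..c, p r) (∫ r in a..c, q r) =
      (∫ s in a..c, B (p s) (∫ r in a..s, q r)) + ∫ s in a..c, B (∫ r in a..s, p r) (q s) := by
  simp only [intervalIntegral.integral_of_le hac]
  rw [bilin_integral_integral_eq_add B (hp.mono_set Set.Ioc_subset_Icc_self)
    (hq.mono_set Set.Ioc_subset_Icc_self)]
  congr 1 <;> refine setIntegral_congr_fun measurableSet_Ioc fun s hs => ?_
  · rw [intervalIntegral.integral_of_le hs.1.le, Measure.restrict_restrict measurableSet_Iic,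
      Set.Iic_inter_Ioc_of_le hs.2]
  · have h_inter : Set.Iio s ∩ Set.Ioc a c = Set.Ioo a s := by
      ext r
      have := hs.2
      grind
    rw [intervalIntegral.integral_of_le hs.1.le, Measure.restrict_restrict measurableSet_Iio,
      h_inter, integral_Ioc_eq_integral_Ioo]

theorem bilin_eq_add_intervalIntegral (B : E →L[ℝ] F →L[ℝ] G) {u p : ℝ → E} {v q : ℝ → F}
    {a c : ℝ} (hac : a ≤ c) (hp : IntegrableOn p (Set.Icc a c))
    (hq : IntegrableOn q (Set.Icc a c)) (hu : ∀ s ∈ Set.Icc a c, u s = u a + ∫ r in a..s, p r)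
    (hv : ∀ s ∈ Set.Icc a c, v s = v a + ∫ r in a..s, q r) :
    B (u c) (v c) = B (u a) (v a) + ∫ s in a..c, (B (p s) (v s) + B (u s) (q s)) := by
  have hpi := (intervalIntegrable_iff_integrableOn_Icc_of_le hac).2 hp
  have hqi := (intervalIntegrable_iff_integrableOn_Icc_of_le hac).2 hq
  have h_left : ∫ s in a..c, B (p s) (v s) =
      B (∫ r in a..c, p r) (v a) + ∫ s in a..c, B (p s) (∫ r in a..s, q r) := by
    have h_const : ∫ s in a..c, B (p s) (v a) = B (∫ r in a..c, p r) (v a) :=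
      (B.flip (v a)).intervalIntegral_comp_comm hpi
    rw [← h_const, ← intervalIntegral.integral_add
      (intervalIntegrable_bilin_of_continuousOn_right B hac hp continuousOn_const)
      (intervalIntegrable_bilin_of_continuousOn_right B hac hp (continuousOn_primitive_Icc hac hq))]
    refine intervalIntegral.integral_congr fun s hs => ?_
    rw [← map_add, ← hv s (Set.uIcc_of_le hac ▸ hs)]
  have h_right : ∫ s in a..c, B (u s) (q s) =
      B (u a) (∫ r in a..c, q r) + ∫ s in a..c, B (∫ r in a..s, p r) (q s) := by
    rw [← (B (u a)).intervalIntegral_comp_comm hqi, ← intervalIntegral.integral_add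
      (intervalIntegrable_bilin_of_continuousOn_left B hac continuousOn_const hq)
      (intervalIntegrable_bilin_of_continuousOn_left B hac (continuousOn_primitive_Icc hac hp) hq)]
    refine intervalIntegral.integral_congr fun s hs => ?_
    rw [← add_apply, ← map_add, ← hu s (Set.uIcc_of_le hac ▸ hs)]
  have hc := Set.right_mem_Icc.2 hac
  have hv_cont : ContinuousOn v (Set.Icc a c) :=
    (continuousOn_const.add (continuousOn_primitive_Icc hac hq)).congr hv
  have hu_cont : ContinuousOn u (Set.Icc a c) :=
    (continuousOn_const.add (continuousOn_primitive_Icc hac hp)).congr hu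
  rw [intervalIntegral.integral_add
    (intervalIntegrable_bilin_of_continuousOn_right B hac hp hv_cont)
    (intervalIntegrable_bilin_of_continuousOn_left B hac hu_cont hq), h_left, h_right,
    hu c hc, hv c hc, map_add, map_add, add_apply, add_apply,
    bilin_intervalIntegral_eq_add B hac hp hq]
  abel

end ProductRule

section Sobolev

variable {𝕜 : Type*} [RCLike 𝕜] {n : ℕ} {a b : ℝ}

local notation "V" => EuclideanSpace 𝕜 (Fin n)

theorem IsH1.integrableOn_Icc {f g : ℝ → V} (h : IsH1 a b f g) {c : ℝ} (hc : c ≤ b) :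
    IntegrableOn g (Set.Icc a c) :=
  h.intervalIntegrable.mono_set (Set.Icc_subset_Icc_right hc)

theorem memLp_intervalMeasure_of_continuousOn {F : Type*} [NormedAddCommGroup F] {f : ℝ → F}
    (hf : ContinuousOn f (Set.Icc a b)) (p : ℝ≥0∞) : MemLp f p (intervalMeasure a b) := by
  obtain ⟨C, hC⟩ := isCompact_Icc.exists_bound_of_continuousOn hf
  exact MemLp.of_bound (hf.aestronglyMeasurable measurableSet_Icc) C
    ((ae_restrict_iff' measurableSet_Icc).2 (Eventually.of_forall hC))

theorem IsH1.clm_apply {f g : ℝ → V} (h : IsH1 a b f g) {Φ Φ' : ℝ → V →L[𝕜] V}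
    (hΦ : ∀ s, HasDerivAt Φ (Φ' s) s) (hΦ' : Continuous Φ') :
    IsH1 a b (fun s => Φ s (f s)) (fun s => Φ' s (f s) + Φ s (g s)) := by
  have hΦ_cont : Continuous Φ := continuous_iff_continuousAt.2 fun s => (hΦ s).continuousAt
  let ev : (V →L[𝕜] V) →L[𝕜] V →L[𝕜] V := ContinuousLinearMap.id 𝕜 (V →L[𝕜] V)
  have h_fst : MemLp (fun s => Φ' s (f s)) 2 (intervalMeasure a b) :=
    memLp_intervalMeasure_of_continuousOn (hΦ'.continuousOn.clm_apply h.continuousOn) 2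
  have h_snd : MemLp (fun s => Φ s (g s)) 2 (intervalMeasure a b) :=
    ev.memLp_of_bilin 2 (memLp_intervalMeasure_of_continuousOn hΦ_cont.continuousOn ∞) h.memLp
  have h_primitive : ∀ s, Φ s = Φ a + ∫ r in a..s, Φ' r := fun s => by
    rw [intervalIntegral.integral_eq_sub_of_hasDerivAt (fun x _ => hΦ x)
      (hΦ'.intervalIntegrable _ _), add_sub_cancel]
  exact ⟨h_fst.add h_snd, fun ξ hξ =>
    bilin_eq_add_intervalIntegral (ev.bilinearRestrictScalars ℝ) hξ.1 hΦ'.integrableOn_Icc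
      (h.integrableOn_Icc hξ.2) (fun s _ => h_primitive s)
      fun s hs => h.eq_integral s ⟨hs.1, hs.2.trans hξ.2⟩⟩

theorem IsH1.two_mul_integral_re_inner (hab : a ≤ b) {f g : ℝ → V} (h : IsH1 a b f g)
    {P : V →L[𝕜] V} (hP : (P : V →ₗ[𝕜] V).IsSymmetric) :
    2 * ∫ s in a..b, RCLike.re (inner 𝕜 (f s) (P (g s))) =
      RCLike.re (inner 𝕜 (f b) (P (f b))) - RCLike.re (inner 𝕜 (f a) (P (f a))) := by
  have h_Pf : ∀ s ∈ Set.Icc a b, P (f s) = P (f a) + ∫ r in a..s, P (g r) := fun s hs => by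
    rw [h.eq_integral s hs, map_add, ← P.intervalIntegral_comp_comm
      ((intervalIntegrable_iff_integrableOn_Icc_of_le hs.1).2 (h.integrableOn_Icc hs.2))]
  let B : V →L[ℝ] V →L[ℝ] ℝ := (ContinuousLinearMap.compL ℝ V 𝕜 ℝ RCLike.reCLM).comp
    (isBoundedBilinearMap_inner (𝕜 := 𝕜) (E := V)).toContinuousLinearMap
  have h_product : RCLike.re (inner 𝕜 (f b) (P (f b))) = RCLike.re (inner 𝕜 (f a) (P (f a))) +
      ∫ s in a..b, (RCLike.re (inner 𝕜 (g s) (P (f s))) + RCLike.re (inner 𝕜 (f s) (P (g s)))) :=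
    bilin_eq_add_intervalIntegral B (v := fun s => P (f s)) hab h.intervalIntegrable
      (P.integrable_comp h.intervalIntegrable) h.eq_integral h_Pf
  rw [h_product, add_sub_cancel_left, ← intervalIntegral.integral_const_mul]
  congr 1 with s
  have h_symm : inner 𝕜 (g s) (P (f s)) = inner 𝕜 (P (g s)) (f s) := (hP (g s) (f s)).symm
  rw [h_symm, inner_re_symm, two_mul]

end Sobolev

section MultiplicationOperators

variable {𝕜 : Type*} [RCLike 𝕜] {V : Type*} [NormedAddCommGroup V] [NormedSpace 𝕜 V]
  {α : Type*} [MeasurableSpace α] {μ : Measure α}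

theorem memLp_sum_smul_const {ι κ : Type*} [Fintype ι] [Fintype κ] {c : ι → κ → α → 𝕜}
    {p : ℝ≥0∞} (hc : ∀ i j, MemLp (c i j) p μ) (v : ι → κ → V) :
    MemLp (fun ξ => ∑ i, ∑ j, c i j ξ • v i j) p μ :=
  memLp_finsetSum _ fun i _ => memLp_finsetSum _ fun j _ =>
    (ContinuousLinearMap.toSpanSingleton 𝕜 (v i j)).comp_memLp' (hc i j)

theorem memLp_toEuclideanCLM {n : ℕ} {A : α → Matrix (Fin n) (Fin n) 𝕜} {p : ℝ≥0∞}
    (hA : ∀ i j, MemLp (fun ξ => A ξ i j) p μ) :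
    MemLp (fun ξ => Matrix.toEuclideanCLM (𝕜 := 𝕜) (A ξ)) p μ := by
  refine (memLp_congr_ae (Eventually.of_forall fun ξ => ?_)).1 (memLp_sum_smul_const hA
    fun i j => Matrix.toEuclideanCLM (𝕜 := 𝕜) (Matrix.single i j (1 : 𝕜)))
  conv_rhs => rw [Matrix.matrix_eq_sum_single (A ξ)]
  simp only [map_sum, ← map_smul, Matrix.smul_single, smul_eq_mul, mul_one]

variable {p : ℝ≥0∞} [Fact (1 ≤ p)]

/-- Multiplication by an essentially bounded operator-valued function, as an operator on `Lᵖ`. -/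
noncomputable def multOp (F : α → V →L[𝕜] V) (hF : MemLp F ∞ μ) : Lp V p μ →L[𝕜] Lp V p μ :=
  (ContinuousLinearMap.id 𝕜 (V →L[𝕜] V)).holderL μ ∞ p p hF.toLp

theorem coeFn_multOp {F : α → V →L[𝕜] V} (hF : MemLp F ∞ μ) (x : Lp V p μ) :
    multOp F hF x =ᵐ[μ] fun ξ => F ξ (x ξ) := by
  filter_upwards [(ContinuousLinearMap.id 𝕜 (V →L[𝕜] V)).coeFn_holder (r := p) hF.toLp x,
    hF.coeFn_toLp] with ξ h_holder h_toLp
  exact h_holder.trans (by rw [h_toLp]; rfl)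

theorem multOp_apply_multOp {F F' : α → V →L[𝕜] V} (hF : MemLp F ∞ μ) (hF' : MemLp F' ∞ μ)
    (h : ∀ᵐ ξ ∂μ, F ξ * F' ξ = 1) (x : Lp V p μ) : multOp F hF (multOp F' hF' x) = x := by
  refine Lp.ext ?_
  filter_upwards [coeFn_multOp hF (multOp F' hF' x), coeFn_multOp hF' x, h] with ξ h_out h_in hξ
  rw [h_out, h_in, ← mul_apply_eq_comp, hξ, one_apply_eq_self]

/-- Multiplication by an almost everywhere invertible function, as an automorphism of `Lᵖ`. -/
noncomputable def multEquiv (F F' : α → V →L[𝕜] V) (hF : MemLp F ∞ μ) (hF' : MemLp F' ∞ μ)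
    (h : ∀ᵐ ξ ∂μ, F ξ * F' ξ = 1) (h' : ∀ᵐ ξ ∂μ, F' ξ * F ξ = 1) : Lp V p μ ≃L[𝕜] Lp V p μ :=
  ContinuousLinearEquiv.equivOfInverse (multOp F hF) (multOp F' hF')
    (multOp_apply_multOp hF' hF h') (multOp_apply_multOp hF hF' h)

end MultiplicationOperators

section BoundedPerturbation

variable {𝕜 : Type*} [RCLike 𝕜] {n : ℕ} {a b : ℝ}

theorem mem_opGraph_iff_sub_multOp (P₁ : Matrix (Fin n) (Fin n) 𝕜)
    {P₀ : ℝ → Matrix (Fin n) (Fin n) 𝕜}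
    (hP₀ : ∀ i j, MemLp (fun ξ => P₀ ξ i j) ∞ (intervalMeasure a b))
    (W : Matrix (Fin n) (Fin n ⊕ Fin n) 𝕜) (x z : StateSpace 𝕜 n a b) :
    (x, z) ∈ opGraph P₁ P₀ W a b ↔
      (x, z - multOp (fun ξ => Matrix.toEuclideanCLM (𝕜 := 𝕜) (P₀ ξ)) (memLp_toEuclideanCLM hP₀) x)
        ∈ opGraph P₁ 0 W a b := by
  refine exists_congr fun f => exists_congr fun g => and_congr_right fun _ =>
    and_congr_right fun hx => and_congr_right fun _ => ?_
  have h_pointwise : ∀ᵐ ξ ∂(intervalMeasure a b),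
      (z ξ = P₁.toEuclideanLin (g ξ) + (P₀ ξ).toEuclideanLin (f ξ) ↔
        (z - multOp _ (memLp_toEuclideanCLM hP₀) x : StateSpace 𝕜 n a b) ξ = P₁.toEuclideanLin (g ξ)
          + ((0 : ℝ → Matrix (Fin n) (Fin n) 𝕜) ξ).toEuclideanLin (f ξ)) := by
    filter_upwards [Lp.coeFn_sub z (multOp _ (memLp_toEuclideanCLM hP₀) x),
      coeFn_multOp (memLp_toEuclideanCLM hP₀) x, hx] with ξ h_sub h_mult hxξ
    rw [h_sub, Pi.sub_apply, h_mult, hxξ, Pi.zero_apply, map_zero, LinearMap.zero_apply, add_zero]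
    exact sub_eq_iff_eq_add.symm
  exact eventually_congr h_pointwise

end BoundedPerturbation

section ExponentialWeight

variable {𝕜 : Type*} [RCLike 𝕜] {X : Type*} [NormedAddCommGroup X] [NormedSpace 𝕜 X]
  [CompleteSpace X]

theorem mul_expOp_of_mul_eq_smul {Q G : X →L[𝕜] X} {μ : ℝ} (h : Q * G = (μ : 𝕜) • Q) (t : ℝ) :
    Q * expOp G t = ((Real.exp (t * μ) : ℝ) : 𝕜) • Q := by
  let _ : NormedAlgebra ℚ (X →L[𝕜] X) := NormedAlgebra.restrictScalars ℚ 𝕜 _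
  have h_semiconj : SemiconjBy Q ((t : 𝕜) • G) ((t : 𝕜) • (μ : 𝕜) • (1 : X →L[𝕜] X)) := by
    rw [SemiconjBy, mul_smul_comm, h, smul_mul_assoc, smul_mul_assoc, one_mul]
  have h_exp : Q * expOp G t = expOp ((μ : 𝕜) • (1 : X →L[𝕜] X)) t * Q :=
    h_semiconj.exp_right
  rw [h_exp, expOp_smul_one, smul_mul_assoc, one_mul]

variable [NormedSpace ℝ X] [IsScalarTower ℝ 𝕜 X] {a b : ℝ} {p : ℝ≥0∞} [Fact (1 ≤ p)]

theorem memLp_expOp_comp (G : X →L[𝕜] X) {φ : ℝ → ℝ} (hφ : Continuous φ) :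
    MemLp (fun s => expOp G (φ s)) ∞ (intervalMeasure a b) :=
  memLp_intervalMeasure_of_continuousOn ((continuous_expOp G).comp hφ).continuousOn ∞

variable (a b) in
/-- Multiplication by `s ↦ exp ((s - m) G)`, as an automorphism of `Lᵖ([a,b])`. -/
noncomputable def expEquiv (G : X →L[𝕜] X) (m : ℝ) :
    Lp X p (intervalMeasure a b) ≃L[𝕜] Lp X p (intervalMeasure a b) :=
  multEquiv (fun s => expOp G (s - m)) (fun s => expOp G (m - s))
    (memLp_expOp_comp G (by fun_prop)) (memLp_expOp_comp G (by fun_prop))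
    (Eventually.of_forall fun s => by
      rw [← expOp_add, sub_add_sub_cancel, sub_self, expOp_zero])
    (Eventually.of_forall fun s => by
      rw [← expOp_add, sub_add_sub_cancel, sub_self, expOp_zero])

theorem coeFn_expEquiv (G : X →L[𝕜] X) (m : ℝ) (x : Lp X p (intervalMeasure a b)) :
    expEquiv a b G m x =ᵐ[intervalMeasure a b] fun s => expOp G (s - m) (x s) :=
  coeFn_multOp (memLp_expOp_comp G (by fun_prop)) x

end ExponentialWeight

section BoundaryForm

variable {𝕜 : Type*} [RCLike 𝕜] {n : ℕ} {P : Matrix (Fin n) (Fin n) 𝕜}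

local notation "matOp" => Matrix.toEuclideanCLM (n := Fin n) (𝕜 := 𝕜)

theorem matOp_isSymmetric {A : Matrix (Fin n) (Fin n) 𝕜} (hA : A.IsHermitian) :
    (matOp A : EuclideanSpace 𝕜 (Fin n) →ₗ[𝕜] EuclideanSpace 𝕜 (Fin n)).IsSymmetric :=
  Matrix.isSymmetric_toEuclideanLin_iff.2 hA

theorem isHermitian_Qplus (hP : P.IsHermitian) : (Qplus P).IsHermitian := by
  rw [Qplus_eq_cfc hP]
  exact cfc_predicate _ _

theorem isHermitian_Qminus (hP : P.IsHermitian) : (Qminus P).IsHermitian :=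
  isHermitian_Qplus hP.neg

theorem re_inner_matOp_mul_self {A : Matrix (Fin n) (Fin n) 𝕜} (hA : A.IsHermitian)
    (v : EuclideanSpace 𝕜 (Fin n)) : RCLike.re (inner 𝕜 v (matOp (A * A) v)) = ‖matOp A v‖ ^ 2 := by
  have h_symm : inner 𝕜 v (matOp A (matOp A v)) = inner 𝕜 (matOp A v) (matOp A v) :=
    (matOp_isSymmetric hA v (matOp A v)).symm
  rw [map_mul, mul_apply_eq_comp, h_symm, ← norm_sq_eq_re_inner]

theorem re_inner_matOp_eq (hP : P.IsHermitian) (v : EuclideanSpace 𝕜 (Fin n)) :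
    RCLike.re (inner 𝕜 v (matOp P v)) = ‖matOp (Qplus P) v‖ ^ 2 - ‖matOp (Qminus P) v‖ ^ 2 := by
  conv_lhs => rw [← Qplus_mul_self_sub_Qminus_mul_self hP]
  rw [map_sub, sub_apply, inner_sub_right, map_sub, re_inner_matOp_mul_self (isHermitian_Qplus hP),
    re_inner_matOp_mul_self (isHermitian_Qminus hP)]

theorem norm_sq_Qplus_add_Qminus (hP : P.IsHermitian) (v w : EuclideanSpace 𝕜 (Fin n)) :
    ‖matOp (Qplus P) v + matOp (Qminus P) w‖ ^ 2 =
      ‖matOp (Qplus P) v‖ ^ 2 + ‖matOp (Qminus P) w‖ ^ 2 := by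
  have h_orthogonal : inner 𝕜 (matOp (Qplus P) v) (matOp (Qminus P) w) = 0 := by
    have h_symm : inner 𝕜 (matOp (Qplus P) v) (matOp (Qminus P) w) =
        inner 𝕜 v (matOp (Qplus P) (matOp (Qminus P) w)) :=
      matOp_isSymmetric (isHermitian_Qplus hP) _ _
    rw [h_symm, ← mul_apply_eq_comp, ← map_mul, Qplus_mul_Qminus hP, map_zero, zero_apply,
      inner_zero_right]
  rw [norm_add_sq (𝕜 := 𝕜), h_orthogonal, map_zero, mul_zero, add_zero]

variable (P) in
/-- The operator `P₊ - P₋`, whose sign distinguishes the directions in which the characteristics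
of `P ∂_ξ` travel. -/
noncomputable def signOp : EuclideanSpace 𝕜 (Fin n) →L[𝕜] EuclideanSpace 𝕜 (Fin n) :=
  matOp (projPlus P - projMinus P)

theorem signOp_commute (hP : P.IsHermitian) : Commute (signOp P) (matOp P) :=
  ((projPlus_commute hP).sub_left (Commute.neg_right_iff.1 (projPlus_commute hP.neg))).map _

theorem Qplus_mul_signOp (hP : P.IsHermitian) :
    matOp (Qplus P) * signOp P = matOp (Qplus P) := by
  rw [signOp, ← map_mul, mul_sub, Qplus_mul_projPlus hP, Qplus_mul_projMinus hP, sub_zero]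

theorem Qminus_mul_signOp (hP : P.IsHermitian) :
    matOp (Qminus P) * signOp P = -matOp (Qminus P) := by
  rw [signOp, ← map_mul, mul_sub, Qminus_mul_projPlus hP, Qminus_mul_projMinus hP, zero_sub,
    map_neg]

theorem re_inner_expOp_signOp (hP : P.IsHermitian) (t : ℝ) (v : EuclideanSpace 𝕜 (Fin n)) :
    RCLike.re (inner 𝕜 (expOp (signOp P) t v) (matOp P (expOp (signOp P) t v))) =
      (Real.exp t * ‖matOp (Qplus P) v‖) ^ 2 - (Real.exp (-t) * ‖matOp (Qminus P) v‖) ^ 2 := by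
  have h_plus := mul_expOp_of_mul_eq_smul (μ := 1)
    ((Qplus_mul_signOp hP).trans (by rw [RCLike.ofReal_one, one_smul])) t
  have h_minus := mul_expOp_of_mul_eq_smul (μ := -1)
    ((Qminus_mul_signOp hP).trans (by rw [RCLike.ofReal_neg, RCLike.ofReal_one, neg_one_smul])) t
  rw [re_inner_matOp_eq hP, ← mul_apply_eq_comp, ← mul_apply_eq_comp, h_plus, h_minus, mul_one,
    mul_neg_one, smul_apply, smul_apply, norm_smul, norm_smul, RCLike.norm_ofReal,
    RCLike.norm_ofReal, Real.abs_exp, Real.abs_exp]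

/-- The inflow is `Q₊ v + Q₋ w` and the outflow `Q₋ v + Q₊ w`; the exponential weights make the
former small enough against the latter to absorb the reflection matrix `M`. -/
theorem re_inner_expOp_signOp_le (hP : P.IsHermitian) {M : Matrix (Fin n) (Fin n) 𝕜} {t : ℝ}
    (hM : ‖matOp M‖ ≤ Real.exp t * Real.exp t) {v w : EuclideanSpace 𝕜 (Fin n)}
    (h : matOp (Qplus P) v + matOp (Qminus P) w =
      matOp M (matOp (Qminus P) v + matOp (Qplus P) w)) :
    RCLike.re (inner 𝕜 (expOp (signOp P) (-t) v) (matOp P (expOp (signOp P) (-t) v))) ≤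
      RCLike.re (inner 𝕜 (expOp (signOp P) t w) (matOp P (expOp (signOp P) t w))) := by
  have h_norm : Real.exp (-t) * ‖matOp (Qplus P) v + matOp (Qminus P) w‖ ≤
      Real.exp t * ‖matOp (Qminus P) v + matOp (Qplus P) w‖ := by
    rw [h, Real.exp_neg, inv_mul_le_iff₀ (Real.exp_pos t), ← mul_assoc]
    exact (matOp M).le_of_opNorm_le hM _
  have h_sq := pow_le_pow_left₀ (by positivity) h_norm 2
  rw [add_comm (matOp (Qminus P) v), mul_pow, mul_pow, norm_sq_Qplus_add_Qminus hP,
    norm_sq_Qplus_add_Qminus hP] at h_sq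
  rw [re_inner_expOp_signOp hP, re_inner_expOp_signOp hP, neg_neg]
  linarith

theorem boundaryValue_eq_zero_iff {K M : Matrix (Fin n) (Fin n) 𝕜} (hK : IsUnit K)
    (a b : ℝ) (f : ℝ → EuclideanSpace 𝕜 (Fin n)) :
    boundaryValue (K * Matrix.fromCols (Qplus P - M * Qminus P) (Qminus P - M * Qplus P)) a b f = 0
      ↔ matOp (Qplus P) (f b) + matOp (Qminus P) (f a) =
        matOp M (matOp (Qminus P) (f b) + matOp (Qplus P) (f a)) := by
  have h_mulVec : Matrix.fromCols (Qplus P - M * Qminus P) (Qminus P - M * Qplus P) *ᵥ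
      Sum.elim (f b) (f a) = (matOp (Qplus P) (f b) + matOp (Qminus P) (f a) -
        matOp M (matOp (Qminus P) (f b) + matOp (Qplus P) (f a))).ofLp := by
    simp only [Matrix.fromCols_mulVec, Function.comp_def, Sum.elim_inl, Sum.elim_inr,
      Matrix.sub_mulVec, ← Matrix.mulVec_mulVec, map_add, Matrix.ofLp_toEuclideanCLM,
      WithLp.ofLp_sub, WithLp.ofLp_add]
    abel
  rw [boundaryValue, ← Matrix.mulVec_mulVec, ← Matrix.mulVec_zero K,
    (Matrix.mulVec_injective_of_isUnit hK).eq_iff, h_mulVec, WithLp.ofLp_eq_zero, sub_eq_zero]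

end BoundaryForm

section WeightedEnergy

variable {𝕜 : Type*} [RCLike 𝕜] {n : ℕ} {a b : ℝ} {P : Matrix (Fin n) (Fin n) 𝕜}

local notation "matOp" => Matrix.toEuclideanCLM (n := Fin n) (𝕜 := 𝕜)

theorem re_inner_eq_intervalIntegral {E : Type*} [NormedAddCommGroup E] [InnerProductSpace 𝕜 E]
    (hab : a ≤ b) {x y : Lp E 2 (intervalMeasure a b)} {f g : ℝ → E}
    (hx : x =ᵐ[intervalMeasure a b] f) (hy : y =ᵐ[intervalMeasure a b] g) :
    RCLike.re (inner 𝕜 x y) = ∫ s in a..b, RCLike.re (inner 𝕜 (f s) (g s)) := by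
  rw [L2.inner_def, ← integral_re (L2.integrable_inner x y), intervalIntegral.integral_of_le hab,
    ← integral_Icc_eq_integral_Ioc]
  refine integral_congr_ae ?_
  filter_upwards [hx, hy] with s hxs hys
  rw [hxs, hys]

/-- If `f` is weighted by `exp ((s - m) G)`, then `P ∂` is perturbed by `P G` only. -/
theorem re_inner_expEquiv_le (hab : a ≤ b) (hP : P.IsHermitian)
    {G : EuclideanSpace 𝕜 (Fin n) →L[𝕜] EuclideanSpace 𝕜 (Fin n)} (hG : Commute G (matOp P))
    {m : ℝ} {f g : ℝ → EuclideanSpace 𝕜 (Fin n)} (h : IsH1 a b f g) {x z : StateSpace 𝕜 n a b}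
    (hx : x =ᵐ[intervalMeasure a b] f) (hz : z =ᵐ[intervalMeasure a b] fun s => matOp P (g s))
    (h_boundary : RCLike.re (inner 𝕜 (expOp G (b - m) (f b)) (matOp P (expOp G (b - m) (f b)))) ≤
      RCLike.re (inner 𝕜 (expOp G (a - m) (f a)) (matOp P (expOp G (a - m) (f a))))) :
    RCLike.re (inner 𝕜 (expEquiv a b G m x) (expEquiv a b G m z)) ≤
      ‖(-(matOp P * G)).compLpL 2 (intervalMeasure a b)‖ * ‖expEquiv a b G m x‖ ^ 2 := by
  set K := (-(matOp P * G)).compLpL 2 (intervalMeasure a b)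
  set S : StateSpace 𝕜 n a b ≃L[𝕜] StateSpace 𝕜 n a b := expEquiv a b G m
  have hu := h.clm_apply (Φ := fun s => expOp G (s - m))
    (fun s => (hasDerivAt_expOp G (s - m)).comp_sub_const s m)
    (((continuous_expOp G).comp (continuous_id.sub continuous_const)).mul continuous_const)
  have hSx : S x =ᵐ[intervalMeasure a b] fun s => expOp G (s - m) (f s) := by
    filter_upwards [coeFn_expEquiv G m x, hx] with s hs hxs
    rw [hs, hxs]
  have hSz : (S z - K (S x) : StateSpace 𝕜 n a b) =ᵐ[intervalMeasure a b]
      fun s => matOp P ((expOp G (s - m) * G) (f s) + expOp G (s - m) (g s)) := by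
    filter_upwards [Lp.coeFn_sub (S z) (K (S x)), coeFn_expEquiv G m z,
      (-(matOp P * G)).coeFn_compLpL (S x), hSx, hz] with s h_sub hSzs hKs hSxs hzs
    rw [h_sub, Pi.sub_apply, hSzs, hKs, hSxs, hzs, map_add, ← mul_apply_eq_comp (expOp G (s - m)),
      (commute_expOp hG _).eq, (commute_expOp (Commute.refl G) _).eq, neg_apply,
      sub_neg_eq_add, add_comm]
    rfl
  have h_energy := hu.two_mul_integral_re_inner hab (matOp_isSymmetric hP)
  rw [← re_inner_eq_intervalIntegral hab hSx hSz, inner_sub_right, map_sub] at h_energy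
  have h_perturbation := re_inner_apply_self_le K (S x)
  linarith

theorem exists_expEquiv_re_inner_le (hab : a < b) (hP : P.IsHermitian)
    {K M : Matrix (Fin n) (Fin n) 𝕜} (hK : IsUnit K) :
    ∃ (S : StateSpace 𝕜 n a b ≃L[𝕜] StateSpace 𝕜 n a b) (ω : ℝ), 0 ≤ ω ∧
      ∀ x z, (x, z) ∈ opGraph P 0
          (K * Matrix.fromCols (Qplus P - M * Qminus P) (Qminus P - M * Qplus P)) a b →
        RCLike.re (inner 𝕜 (S x) (S z)) ≤ ω * ‖S x‖ ^ 2 := by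
  set c : ℝ := ‖matOp M‖ / (b - a) with hc
  set G := ((-c : ℝ) : 𝕜) • signOp P with hG
  set m := (a + b) / 2 with hm
  have h_expOp (t : ℝ) : expOp G t = expOp (signOp P) (-(c * t)) := by
    rw [expOp, expOp, hG, smul_smul, ← RCLike.ofReal_mul]
    congr 3
    ring
  have h_commute : Commute G (matOp P) := ContinuousLinearMap.ext fun v => by
    have h_apply := DFunLike.congr_fun (signOp_commute hP).eq v
    rw [mul_apply_eq_comp, mul_apply_eq_comp] at h_apply
    rw [mul_apply_eq_comp, mul_apply_eq_comp, hG, smul_apply, smul_apply, map_smul, h_apply]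
  have h_small : ‖matOp M‖ ≤ Real.exp (c * (b - m)) * Real.exp (c * (b - m)) := by
    have h_exponent : c * (b - m) + c * (b - m) = ‖matOp M‖ := by
      have := (sub_pos.2 hab).ne'
      rw [hc, hm]
      field_simp
      ring
    rw [← Real.exp_add, h_exponent]
    linarith [Real.add_one_le_exp ‖matOp M‖]
  refine ⟨expEquiv a b G m, ‖(-(matOp P * G)).compLpL 2 (intervalMeasure a b)‖, norm_nonneg _, ?_⟩
  rintro x z ⟨f, g, h, hx, h_boundary, hz⟩
  refine re_inner_expEquiv_le hab.le hP h_commute h hx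
    (hz.trans (Eventually.of_forall fun s => ?_)) ?_
  · simp only [Pi.zero_apply, map_zero, LinearMap.zero_apply, add_zero]
    rfl
  · have h_midpoint : -(c * (a - m)) = c * (b - m) := by ring
    rw [h_expOp, h_expOp, h_midpoint]
    exact re_inner_expOp_signOp_le hP h_small ((boundaryValue_eq_zero_iff hK a b f).1 h_boundary)

end WeightedEnergy

section LinearODE

variable {𝕜 : Type*} [RCLike 𝕜] {n : ℕ} {a b : ℝ}

local notation "V" => EuclideanSpace 𝕜 (Fin n)

theorem boundaryValue_add (W : Matrix (Fin n) (Fin n ⊕ Fin n) 𝕜) (a b : ℝ) (f f' : ℝ → V) :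
    boundaryValue W a b (f + f') = boundaryValue W a b f + boundaryValue W a b f' := by
  rw [boundaryValue, boundaryValue, boundaryValue, ← Matrix.mulVec_add]
  congr 1
  ext (i | i) <;> rfl

theorem boundaryValue_smul (W : Matrix (Fin n) (Fin n ⊕ Fin n) 𝕜) (a b : ℝ) (c : 𝕜) (f : ℝ → V) :
    boundaryValue W a b (c • f) = c • boundaryValue W a b f := by
  rw [boundaryValue, boundaryValue, ← Matrix.mulVec_smul]
  congr 1
  ext (i | i) <;> rfl

theorem isH1_expOp_apply (G : V →L[𝕜] V) (c : V) :
    IsH1 a b (fun s => expOp G (s - a) c) fun s => G (expOp G (s - a) c) := by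
  have h_const : IsH1 a b (fun _ => c) 0 := ⟨MemLp.zero', fun ξ _ => by
    simp only [Pi.zero_apply, intervalIntegral.integral_zero, add_zero]⟩
  have h := h_const.clm_apply (fun s => (hasDerivAt_expOp G (s - a)).comp_sub_const s a)
    (((continuous_expOp G).comp (continuous_id.sub continuous_const)).mul continuous_const)
  convert h using 2 with s
  rw [Pi.zero_apply, map_zero, add_zero, ← mul_apply_eq_comp,
    (commute_expOp (Commute.refl G) _).eq]

theorem exists_isH1_inhomogeneous (G : V →L[𝕜] V) {h : ℝ → V}
    (hh : MemLp h 2 (intervalMeasure a b)) :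
    ∃ f g : ℝ → V, IsH1 a b f g ∧ ∀ s, g s = G (f s) + h s := by
  set q : ℝ → V := fun s => expOp G (a - s) (h s) with hq
  have h_memLp : MemLp q 2 (intervalMeasure a b) :=
    (ContinuousLinearMap.id 𝕜 (V →L[𝕜] V)).memLp_of_bilin 2
      (memLp_expOp_comp G (φ := fun s => a - s) (by fun_prop)) hh
  have h_primitive : IsH1 a b (fun s => ∫ t in a..s, q t) q := ⟨h_memLp, fun ξ _ => by
    rw [intervalIntegral.integral_same, zero_add]⟩
  refine ⟨_, _, h_primitive.clm_apply (fun s => (hasDerivAt_expOp G (s - a)).comp_sub_const s a)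
    (((continuous_expOp G).comp (continuous_id.sub continuous_const)).mul continuous_const),
    fun s => ?_⟩
  have h_inverse : expOp G (s - a) (q s) = h s := by
    rw [hq, ← mul_apply_eq_comp, ← expOp_add, sub_add_sub_cancel, sub_self, expOp_zero,
      one_apply_eq_self]
  rw [h_inverse, ← mul_apply_eq_comp G, (commute_expOp (Commute.refl G) _).eq]

end LinearODE

section Generation

variable {𝕜 : Type*} [RCLike 𝕜] {n : ℕ} {a b : ℝ} {P : Matrix (Fin n) (Fin n) 𝕜}
  {W : Matrix (Fin n) (Fin n ⊕ Fin n) 𝕜}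

local notation "matOp" => Matrix.toEuclideanCLM (n := Fin n) (𝕜 := 𝕜)

theorem matOp_apply_smul_inv_add (hu : IsUnit P) (lam : 𝕜) (v w : EuclideanSpace 𝕜 (Fin n)) :
    matOp P ((lam • matOp P⁻¹) v + matOp P⁻¹ w) = lam • v + w := by
  have h_inv (u : EuclideanSpace 𝕜 (Fin n)) : matOp P (matOp P⁻¹ u) = u := by
    rw [← mul_apply_eq_comp, ← map_mul,
      Matrix.mul_nonsing_inv _ ((Matrix.isUnit_iff_isUnit_det P).1 hu), map_one, one_apply_eq_self]
  rw [smul_apply, map_add, map_smul, h_inv, h_inv]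

theorem IsH1.mem_opGraph {f g : ℝ → EuclideanSpace 𝕜 (Fin n)} (h : IsH1 a b f g)
    (h_boundary : boundaryValue W a b f = 0) {lam : 𝕜} {x y : StateSpace 𝕜 n a b}
    (hx : x =ᵐ[intervalMeasure a b] f)
    (h_ode : ∀ᵐ s ∂intervalMeasure a b, matOp P (g s) = lam • f s - y s) :
    (x, lam • x - y) ∈ opGraph P 0 W a b := by
  refine ⟨f, g, h, hx, h_boundary, ?_⟩
  filter_upwards [hx, h_ode, Lp.coeFn_sub (lam • x) y, Lp.coeFn_smul lam x]
    with s hxs h_ode_s h_sub h_smul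
  simp only [Pi.zero_apply, map_zero, LinearMap.zero_apply, add_zero]
  rw [h_sub, Pi.sub_apply, h_smul, Pi.smul_apply, hxs, ← h_ode_s]
  rfl

theorem IsH1.eqOn_zero_of_dissipative (hab : a < b)
    {S : StateSpace 𝕜 n a b ≃L[𝕜] StateSpace 𝕜 n a b} {ω lam : ℝ} (hlam : ω < lam)
    (h_dissipative : ∀ x z, (x, z) ∈ opGraph P 0 W a b →
      RCLike.re (inner 𝕜 (S x) (S z)) ≤ ω * ‖S x‖ ^ 2)
    {f g : ℝ → EuclideanSpace 𝕜 (Fin n)} (h : IsH1 a b f g) (h_boundary : boundaryValue W a b f = 0)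
    (h_ode : ∀ s, matOp P (g s) = (lam : 𝕜) • f s) : Set.EqOn f 0 (Set.Icc a b) := by
  have h_memLp := memLp_intervalMeasure_of_continuousOn h.continuousOn 2
  obtain ⟨x, hx⟩ : ∃ x : StateSpace 𝕜 n a b, x =ᵐ[intervalMeasure a b] f :=
    ⟨h_memLp.toLp, h_memLp.coeFn_toLp⟩
  have h_zero := Lp.coeFn_zero (EuclideanSpace 𝕜 (Fin n)) 2 (intervalMeasure a b)
  have h_mem := h.mem_opGraph (P := P) h_boundary (lam := (lam : 𝕜)) (y := 0) hx (by
    filter_upwards [h_zero] with s hs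
    rw [h_ode, hs, Pi.zero_apply, sub_zero])
  have h_re := h_dissipative _ _ h_mem
  rw [sub_zero, map_smul] at h_re
  rw [S.map_eq_zero_iff.1 (eq_zero_of_re_inner_smul_le hlam h_re)] at hx
  exact Measure.eqOn_Icc_of_ae_eq volume hab.ne (hx.symm.trans h_zero) h.continuousOn
    continuousOn_const

theorem exists_boundaryValue_expOp_eq (hab : a < b) (hu : IsUnit P)
    {S : StateSpace 𝕜 n a b ≃L[𝕜] StateSpace 𝕜 n a b} {ω lam : ℝ} (hlam : ω < lam)
    (h_dissipative : ∀ x z, (x, z) ∈ opGraph P 0 W a b →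
      RCLike.re (inner 𝕜 (S x) (S z)) ≤ ω * ‖S x‖ ^ 2) (w : Fin n → 𝕜) :
    ∃ c, boundaryValue W a b (fun s => expOp ((lam : 𝕜) • matOp P⁻¹) (s - a) c) = w := by
  set G := (lam : 𝕜) • matOp P⁻¹
  let Γ : EuclideanSpace 𝕜 (Fin n) →ₗ[𝕜] Fin n → 𝕜 :=
    { toFun c := boundaryValue W a b fun s => expOp G (s - a) c
      map_add' c c' := by
        rw [← boundaryValue_add]
        exact congrArg _ (funext fun s => map_add _ c c')
      map_smul' r c := by
        rw [RingHom.id_apply, ← boundaryValue_smul]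
        exact congrArg _ (funext fun s => map_smul _ r c) }
  have h_injective : Function.Injective Γ := by
    refine (injective_iff_map_eq_zero Γ).2 fun c hc => ?_
    have h_zero := (isH1_expOp_apply G c).eqOn_zero_of_dissipative hab hlam h_dissipative hc
      (fun s => by
        have h_inv := matOp_apply_smul_inv_add hu (lam : 𝕜) (expOp G (s - a) c) 0
        rwa [map_zero, add_zero, add_zero] at h_inv)
      (Set.left_mem_Icc.2 hab.le)
    simpa only [sub_self, expOp_zero, one_apply_eq_self, Pi.zero_apply] using h_zero
  exact (LinearMap.injective_iff_surjective_of_finrank_eq_finrank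
    (by rw [finrank_euclideanSpace_fin, Module.finrank_fin_fun])).1 h_injective w

theorem exists_mem_opGraph_smul_sub (hab : a < b) (hu : IsUnit P)
    {S : StateSpace 𝕜 n a b ≃L[𝕜] StateSpace 𝕜 n a b} {ω lam : ℝ} (hlam : ω < lam)
    (h_dissipative : ∀ x z, (x, z) ∈ opGraph P 0 W a b →
      RCLike.re (inner 𝕜 (S x) (S z)) ≤ ω * ‖S x‖ ^ 2) (y : StateSpace 𝕜 n a b) :
    ∃ x, (x, (lam : 𝕜) • x - y) ∈ opGraph P 0 W a b := by
  set G := (lam : 𝕜) • matOp P⁻¹ with hG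
  obtain ⟨f₀, g₀, h₀, h_ode⟩ := exists_isH1_inhomogeneous G
    ((matOp P⁻¹).comp_memLp' (Lp.memLp (-y)))
  obtain ⟨c, hc⟩ := exists_boundaryValue_expOp_eq hab hu hlam h_dissipative
    (-boundaryValue W a b f₀)
  have h := h₀.add (isH1_expOp_apply G c)
  have h_memLp := memLp_intervalMeasure_of_continuousOn h.continuousOn 2
  refine ⟨h_memLp.toLp, h.mem_opGraph ?_ h_memLp.coeFn_toLp ?_⟩
  · rw [boundaryValue_add, hc, add_neg_cancel]
  · filter_upwards [Lp.coeFn_neg y] with s hs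
    have h_inv := matOp_apply_smul_inv_add hu (lam : 𝕜) (f₀ s + expOp G (s - a) c) ((-y) s)
    rw [hs, Pi.neg_apply, ← sub_eq_add_neg] at h_inv
    rw [Pi.add_apply, Pi.add_apply, ← h_inv, h_ode, ← hG, map_add G, add_right_comm,
      Function.comp_apply, hs, Pi.neg_apply]

theorem exists_isQuasiMDissipative_opA (hab : a < b) (hP : P.IsHermitian) (hu : IsUnit P)
    {K : Matrix (Fin n) (Fin n) 𝕜} (hK : IsUnit K) (M : Matrix (Fin n) (Fin n) 𝕜) :
    ∃ S ω, IsQuasiMDissipative (opA P 0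
      (K * Matrix.fromCols (Qplus P - M * Qminus P) (Qminus P - M * Qplus P)) a b) S ω := by
  obtain ⟨S, ω, hω, h_dissipative⟩ := exists_expEquiv_re_inner_le (M := M) hab hP hK
  refine ⟨S, ω, hω, by rwa [opA_graph P 0 _ hab], ?_⟩
  filter_upwards [eventually_gt_atTop ω] with lam hlam y
  rw [opA_graph P 0 _ hab]
  exact exists_mem_opGraph_smul_sub hab hu hlam h_dissipative y

theorem generatesC0Semigroup_opA (hab : a < b) (hP : P.IsHermitian) (hu : IsUnit P)
    {P₀ : ℝ → Matrix (Fin n) (Fin n) 𝕜}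
    (hP₀ : ∀ i j, MemLp (fun ξ => P₀ ξ i j) ∞ (intervalMeasure a b))
    {K : Matrix (Fin n) (Fin n) 𝕜} (hK : IsUnit K) (M : Matrix (Fin n) (Fin n) 𝕜) :
    GeneratesC0Semigroup (opA P P₀
      (K * Matrix.fromCols (Qplus P - M * Qminus P) (Qminus P - M * Qplus P)) a b) := by
  obtain ⟨S, ω, h⟩ := exists_isQuasiMDissipative_opA (a := a) (b := b) hab hP hu hK M
  obtain ⟨ω', h'⟩ := h.add_bounded (A' := opA P P₀ _ a b)
    (multOp (fun ξ => matOp (P₀ ξ)) (memLp_toEuclideanCLM hP₀)) fun x z => by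
      rw [opA_graph P 0 _ hab, opA_graph P P₀ _ hab]
      exact mem_opGraph_iff_sub_multOp P hP₀ _ x z
  exact h'.generatesC0Semigroup

end Generation

section LpEstimates

variable {α : Type*} {m : MeasurableSpace α} {μ : Measure α} [IsFiniteMeasure μ]
  {E : Type*} [NormedAddCommGroup E]

theorem norm_integral_le_mul_norm [NormedSpace ℝ E] {p : ℝ≥0∞} [Fact (1 ≤ p)] (x : Lp E p μ) :
    ‖∫ s, x s ∂μ‖ ≤ (μ Set.univ ^ (1 - 1 / p.toReal)).toReal * ‖x‖ := by
  have h_eLpNorm : ‖∫ s, x s ∂μ‖ₑ ≤ eLpNorm x p μ * μ Set.univ ^ (1 - 1 / p.toReal) := by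
    refine (enorm_integral_le_lintegral_enorm _).trans ?_
    rw [← eLpNorm_one_eq_lintegral_enorm]
    simpa using eLpNorm_le_eLpNorm_mul_rpow_measure_univ (Fact.out : 1 ≤ p)
      (Lp.aestronglyMeasurable x)
  have h_ne_top : eLpNorm x p μ * μ Set.univ ^ (1 - 1 / p.toReal) ≠ ∞ := by
    refine ENNReal.mul_ne_top (Lp.eLpNorm_ne_top x) (ENNReal.rpow_ne_top_of_nonneg ?_
      (measure_ne_top μ _))
    rcases eq_or_ne p ∞ with rfl | hp_top
    · simp
    · have hp := ENNReal.toReal_mono hp_top (Fact.out : 1 ≤ p)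
      exact sub_nonneg.2 (div_le_one_of_le₀ hp ENNReal.toReal_nonneg)
  rw [← toReal_enorm, mul_comm, Lp.norm_def, ← ENNReal.toReal_mul]
  exact ENNReal.toReal_mono h_ne_top h_eLpNorm

theorem tendsto_eLpNorm_zero_of_bounded {ι : Type*} {l : Filter ι} [l.IsCountablyGenerated]
    {p : ℝ≥0∞} (hp_zero : p ≠ 0) (hp_top : p ≠ ∞) {F : ι → α → E} {C : ℝ}
    (h_measurable : ∀ i, AEStronglyMeasurable (F i) μ)
    (h_bound : ∀ᶠ i in l, ∀ᵐ s ∂μ, ‖F i s‖ ≤ C)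
    (h_tendsto : ∀ᵐ s ∂μ, Tendsto (fun i => F i s) l (𝓝 0)) :
    Tendsto (fun i => eLpNorm (F i) p μ) l (𝓝 0) := by
  have hp_pos : 0 < p.toReal := ENNReal.toReal_pos hp_zero hp_top
  have h_lintegral : Tendsto (fun i => ∫⁻ s, ‖F i s‖ₑ ^ p.toReal ∂μ) l (𝓝 (∫⁻ _, 0 ∂μ)) := by
    refine tendsto_lintegral_filter_of_dominated_convergence'
      (fun _ => ENNReal.ofReal C ^ p.toReal)
      (Eventually.of_forall fun i => (h_measurable i).enorm.pow_const _) ?_ ?_ ?_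
    · filter_upwards [h_bound] with i hi
      filter_upwards [hi] with s hs
      gcongr
      rw [← ofReal_norm]
      exact ENNReal.ofReal_le_ofReal hs
    · rw [lintegral_const]
      exact ENNReal.mul_ne_top
        (ENNReal.rpow_ne_top_of_nonneg hp_pos.le ENNReal.ofReal_ne_top) (measure_ne_top μ _)
    · filter_upwards [h_tendsto] with s hs
      have h := (ENNReal.continuous_rpow_const (y := p.toReal)).tendsto 0 |>.comp
        (by simpa using hs.enorm)
      rwa [ENNReal.zero_rpow_of_pos hp_pos] at h
  rw [lintegral_zero] at h_lintegral
  have h := (ENNReal.continuous_rpow_const (y := 1 / p.toReal)).tendsto 0 |>.comp h_lintegral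
  rw [ENNReal.zero_rpow_of_pos (one_div_pos.2 hp_pos)] at h
  refine h.congr fun i => ?_
  rw [eLpNorm_eq_lintegral_rpow_enorm_toReal hp_zero hp_top]
  rfl

theorem tendsto_eLpNorm_exp_smul [NormedSpace ℝ E] {p : ℝ≥0∞} (hp_zero : p ≠ 0) (hp_top : p ≠ ∞)
    {φ : α → ℝ} (hφ : AEMeasurable φ μ) (hφ_neg : ∀ᵐ s ∂μ, φ s < 0) (w : E) :
    Tendsto (fun lam : ℝ => eLpNorm (fun s => Real.exp (lam * φ s) • w) p μ) atTop (𝓝 0) := by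
  refine tendsto_eLpNorm_zero_of_bounded hp_zero hp_top (C := ‖w‖) (fun lam => ?_) ?_ ?_
  · exact (hφ.const_mul lam).exp.aestronglyMeasurable.smul_const w
  · filter_upwards [eventually_ge_atTop 0] with lam h_lam
    filter_upwards [hφ_neg] with s hs
    rw [norm_smul, Real.norm_of_nonneg (Real.exp_pos _).le]
    exact mul_le_of_le_one_left (norm_nonneg w)
      (Real.exp_le_one_iff.2 (mul_nonpos_of_nonneg_of_nonpos h_lam hs.le))
  · filter_upwards [hφ_neg] with s hs
    simpa only [zero_smul, Function.comp_apply, id] using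
      (Real.tendsto_exp_atBot.comp (tendsto_id.atTop_mul_const_of_neg hs)).smul_const w

end LpEstimates

section TraceBound

variable {𝕜 : Type*} [RCLike 𝕜]

theorem GeneratesC0Semigroup.exists_norm_le {X : Type*} [NormedAddCommGroup X]
    [NormedSpace 𝕜 X] [NormedSpace ℝ X] [IsScalarTower ℝ 𝕜 X] [CompleteSpace X]
    {A : X →ₗ.[𝕜] X} (hA : GeneratesC0Semigroup A) (B : X →L[𝕜] X) :
    ∃ C : ℝ, ∀ᶠ lam : ℝ in atTop, ∀ x z, (x, z + B x) ∈ A.graph →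
      ‖z‖ ≤ C * ‖(lam : 𝕜) • x - z‖ := by
  obtain ⟨T, hT, h_generator⟩ := hA
  obtain ⟨C, hC, h_resolvent⟩ := hT.exists_resolvent_bound
  refine ⟨2 * C + 1, ?_⟩
  filter_upwards [h_resolvent, eventually_ge_atTop (2 * C * ‖B‖), eventually_ge_atTop 0]
    with lam h_lam h_large h_nonneg x z hxz
  have h_perturbed : lam * ‖x‖ ≤ C * (‖(lam : 𝕜) • x - z‖ + ‖B‖ * ‖x‖) := by
    refine (h_lam x (z + B x) ((h_generator _ _).1 hxz)).trans ?_
    rw [← sub_sub]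
    gcongr
    exact (norm_sub_le _ _).trans (by gcongr; exact B.le_opNorm x)
  have h_absorb : 2 * C * ‖B‖ * ‖x‖ ≤ lam * ‖x‖ := by gcongr
  calc ‖z‖ = ‖(lam : 𝕜) • x - ((lam : 𝕜) • x - z)‖ := by rw [sub_sub_cancel]
    _ ≤ lam * ‖x‖ + ‖(lam : 𝕜) • x - z‖ := by
        refine (norm_sub_le _ _).trans_eq ?_
        rw [norm_smul, RCLike.norm_ofReal, abs_of_nonneg h_nonneg]
    _ ≤ (2 * C + 1) * ‖(lam : 𝕜) • x - z‖ := by linarith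

variable {n : ℕ} {a b : ℝ} {P : Matrix (Fin n) (Fin n) 𝕜}

local notation "matOp" => Matrix.toEuclideanCLM (n := Fin n) (𝕜 := 𝕜)

theorem IsH1.integral_eq_clm_apply_sub (hab : a ≤ b) {f g : ℝ → EuclideanSpace 𝕜 (Fin n)}
    (h : IsH1 a b f g) (L : EuclideanSpace 𝕜 (Fin n) →L[𝕜] EuclideanSpace 𝕜 (Fin n)) :
    ∫ s, L (g s) ∂intervalMeasure a b = L (f b - f a) := by
  rw [h.eq_integral b (Set.right_mem_Icc.2 hab), add_sub_cancel_left,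
    intervalIntegral.integral_of_le hab, ← integral_Icc_eq_integral_Ioc]
  exact (L.integral_comp_comm h.intervalIntegrable)

theorem exists_norm_trace_le (hab : a < b) {P₀ : ℝ → Matrix (Fin n) (Fin n) 𝕜}
    (hP₀ : ∀ i j, MemLp (fun ξ => P₀ ξ i j) ∞ (intervalMeasure a b))
    {W : Matrix (Fin n) (Fin n ⊕ Fin n) 𝕜} (hA : GeneratesC0Semigroup (opA P P₀ W a b)) :
    ∃ C : ℝ, ∀ᶠ lam : ℝ in atTop, ∀ f g : ℝ → EuclideanSpace 𝕜 (Fin n), IsH1 a b f g →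
      boundaryValue W a b f = 0 → ‖matOp P (f b - f a)‖ ≤ C *
        (eLpNorm (fun s => (lam : 𝕜) • f s - matOp P (g s)) 2 (intervalMeasure a b)).toReal := by
  set B := multOp (p := 2) (fun ξ => matOp (P₀ ξ)) (memLp_toEuclideanCLM hP₀)
  obtain ⟨C, hC⟩ := hA.exists_norm_le B
  set N := (intervalMeasure a b Set.univ ^ (1 - 1 / (2 : ℝ≥0∞).toReal)).toReal
  refine ⟨N * C, hC.mono fun lam h_lam f g h h_boundary => ?_⟩
  have hf := memLp_intervalMeasure_of_continuousOn h.continuousOn 2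
  have hg := (matOp P).comp_memLp' h.memLp
  set x : StateSpace 𝕜 n a b := hf.toLp
  set z : StateSpace 𝕜 n a b := hg.toLp
  have h_graph : (x, z + B x) ∈ (opA P P₀ W a b).graph := by
    rw [opA_graph P P₀ W hab, mem_opGraph_iff_sub_multOp P hP₀, add_sub_cancel_right]
    refine ⟨f, g, h, hf.coeFn_toLp, h_boundary, hg.coeFn_toLp.trans ?_⟩
    refine Eventually.of_forall fun s => ?_
    simp only [Pi.zero_apply, map_zero, LinearMap.zero_apply, add_zero]
    rfl
  have h_residual : ‖(lam : 𝕜) • x - z‖ =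
      (eLpNorm (fun s => (lam : 𝕜) • f s - matOp P (g s)) 2 (intervalMeasure a b)).toReal := by
    rw [← MemLp.toLp_const_smul, ← MemLp.toLp_sub, Lp.norm_toLp]
    rfl
  calc ‖matOp P (f b - f a)‖ = ‖∫ s, z s ∂intervalMeasure a b‖ := by
        rw [integral_congr_ae hg.coeFn_toLp]
        exact congrArg _ (h.integral_eq_clm_apply_sub hab.le (matOp P)).symm
    _ ≤ N * ‖z‖ := norm_integral_le_mul_norm _
    _ ≤ N * C * _ := by
        rw [mul_assoc, ← h_residual]
        exact mul_le_mul_of_nonneg_left (h_lam x z h_graph) ENNReal.toReal_nonneg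

end TraceBound

section BoundaryLayers

variable {𝕜 : Type*} [RCLike 𝕜] {n : ℕ} {P : Matrix (Fin n) (Fin n) 𝕜} {a b : ℝ}
  {f g f' g' : ℝ → ℝ → EuclideanSpace 𝕜 (Fin n)}

local notation "V" => EuclideanSpace 𝕜 (Fin n)

local notation "matOp" => Matrix.toEuclideanCLM (n := Fin n) (𝕜 := 𝕜)

theorem IsH1.of_hasDerivAt {f g : ℝ → V} (h : ∀ s, HasDerivAt f (g s) s) (hg : Continuous g) :
    IsH1 a b f g :=
  ⟨memLp_intervalMeasure_of_continuousOn hg.continuousOn 2, fun ξ _ => by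
    rw [intervalIntegral.integral_eq_sub_of_hasDerivAt (fun x _ => h x)
      (hg.intervalIntegrable _ _), add_sub_cancel]⟩

/-- `f lam` with derivative `g lam` is a family of approximate solutions of `lam x = P x'`: the
residual tends to `0` in `L²([a,b], 𝕜ⁿ)` as `lam → ∞`. Keeping the boundary values fixed forces such
a family to concentrate in a layer at the boundary. -/
structure IsBoundaryLayer (P : Matrix (Fin n) (Fin n) 𝕜) (a b : ℝ) (f g : ℝ → ℝ → V) : Prop where
  isH1 : ∀ lam, IsH1 a b (f lam) (g lam)
  tendsto_residual : Tendsto (fun lam : ℝ =>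
    eLpNorm (fun s => (lam : 𝕜) • f lam s - matOp P (g lam s)) 2 (intervalMeasure a b)) atTop (𝓝 0)

theorem IsBoundaryLayer.memLp_residual (h : IsBoundaryLayer P a b f g) (lam : ℝ) :
    MemLp (fun s => (lam : 𝕜) • f lam s - matOp P (g lam s)) 2 (intervalMeasure a b) :=
  ((memLp_intervalMeasure_of_continuousOn (h.isH1 lam).continuousOn 2).const_smul (lam : 𝕜)).sub
    ((matOp P).comp_memLp' (h.isH1 lam).memLp)

theorem IsBoundaryLayer.add (h : IsBoundaryLayer P a b f g) (h' : IsBoundaryLayer P a b f' g') :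
    IsBoundaryLayer P a b (f + f') (g + g') := by
  refine ⟨fun lam => (h.isH1 lam).add (h'.isH1 lam), ?_⟩
  refine tendsto_of_tendsto_of_tendsto_of_le_of_le tendsto_const_nhds
    (by simpa only [add_zero] using h.tendsto_residual.add h'.tendsto_residual)
    (fun _ => zero_le) fun lam => ?_
  refine le_of_eq_of_le (congrArg (eLpNorm · 2 _) (funext fun s => ?_))
    (eLpNorm_add_le (h.memLp_residual lam).1 (h'.memLp_residual lam).1 one_le_two)
  simp only [Pi.add_apply, smul_add, map_add]
  abel

theorem IsBoundaryLayer.smul (c : 𝕜) (h : IsBoundaryLayer P a b f g) :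
    IsBoundaryLayer P a b (c • f) (c • g) := by
  refine ⟨fun lam => (h.isH1 lam).smul c, ?_⟩
  have h_tendsto := ENNReal.Tendsto.const_mul h.tendsto_residual (a := ‖c‖ₑ) (Or.inr enorm_ne_top)
  rw [mul_zero] at h_tendsto
  refine h_tendsto.congr fun lam => ?_
  rw [← eLpNorm_const_smul]
  refine congrArg (eLpNorm · 2 _) (funext fun s => ?_)
  simp only [Pi.smul_apply, smul_sub, map_smul, smul_comm c]

variable (P a b) in
/-- The pairs `(v, w)` that are the boundary values `f lam b = v`, `f lam a = w`, independent of
`lam`, of a boundary layer `f`. -/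
def boundaryLayerValues : Submodule 𝕜 (V × V) where
  carrier := {p | ∃ f g, IsBoundaryLayer P a b f g ∧ ∀ lam, f lam b = p.1 ∧ f lam a = p.2}
  zero_mem' := by
    refine ⟨0, 0, ⟨fun _ => IsH1.of_hasDerivAt (fun s => hasDerivAt_const s 0) continuous_const,
      ?_⟩, fun _ => ⟨rfl, rfl⟩⟩
    simp only [Pi.zero_apply, smul_zero, map_zero, sub_zero, eLpNorm_zero', tendsto_const_nhds]
  add_mem' := by
    rintro p p' ⟨f, g, h, h_values⟩ ⟨f', g', h', h_values'⟩
    exact ⟨f + f', g + g', h.add h', fun lam =>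
      ⟨congrArg₂ (· + ·) (h_values lam).1 (h_values' lam).1,
        congrArg₂ (· + ·) (h_values lam).2 (h_values' lam).2⟩⟩
  smul_mem' := by
    rintro c p ⟨f, g, h, h_values⟩
    exact ⟨c • f, c • g, h.smul c, fun lam =>
      ⟨congrArg (c • ·) (h_values lam).1, congrArg (c • ·) (h_values lam).2⟩⟩

/-- The residual is of the order of `exp (lam (s - p) / μ)`: the factor `(s - q) / (p - q)`, which
provides the boundary value `0` at `q`, does not contribute a factor `lam` when differentiated. -/
theorem exists_isBoundaryLayer_of_eigenvector {w : V} {μ p q : ℝ}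
    (hw : matOp P w = (μ : 𝕜) • w) (hμ : μ ≠ 0) (hpq : p ≠ q)
    (h_decay : ∀ s ∈ Set.Icc a b, s ≠ p → (s - p) / μ < 0) :
    ∃ f g, IsBoundaryLayer P a b f g ∧ ∀ lam, f lam p = w ∧ f lam q = 0 := by
  have hpq' : p - q ≠ 0 := sub_ne_zero.2 hpq
  set e : ℝ → ℝ → ℝ := fun lam s => Real.exp (lam * ((s - p) / μ)) with he
  have h_exp (lam s : ℝ) : HasDerivAt (e lam) (e lam s * (lam * (1 / μ))) s :=
    ((((hasDerivAt_id s).sub_const p).div_const μ).const_mul lam).exp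
  have h_profile (lam s : ℝ) := ((h_exp lam s).mul
    (((hasDerivAt_id s).sub_const q).div_const (p - q))).smul_const w
  have h_residual (lam s : ℝ) : (lam : 𝕜) • ((e lam s * ((s - q) / (p - q))) • w) -
      matOp P ((e lam s * (lam * (1 / μ)) * ((s - q) / (p - q)) + e lam s * (1 / (p - q))) • w) =
      e lam s • (-(μ / (p - q)) • w) := by
    rw [(matOp P).map_smul_of_tower, hw, ← RCLike.real_smul_eq_coe_smul,
      ← RCLike.real_smul_eq_coe_smul, smul_smul, smul_smul, smul_smul, ← sub_smul]
    congr 1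
    field_simp
    ring
  have h_ae_decay : ∀ᵐ s ∂intervalMeasure a b, (s - p) / μ < 0 := by
    filter_upwards [ae_restrict_mem measurableSet_Icc, Measure.ae_ne _ p] with s hs hsp
    exact h_decay s hs hsp
  refine ⟨fun lam s => (e lam s * ((s - q) / (p - q))) • w, _, ⟨fun lam =>
    IsH1.of_hasDerivAt (h_profile lam) (by fun_prop), ?_⟩, fun lam => ⟨?_, ?_⟩⟩
  · simp only [id, h_residual]
    exact tendsto_eLpNorm_exp_smul two_ne_zero ENNReal.ofNat_ne_top (by fun_prop) h_ae_decay _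
  · simp only [he, sub_self, zero_div, mul_zero, Real.exp_zero, one_mul, div_self hpq', one_smul]
  · simp only [sub_self, zero_div, mul_zero, zero_smul]

variable (P) in
theorem projPlus_apply_mem (u : V) : matOp (projPlus P) u ∈ posSpace P := by
  change (projPlus P).toEuclideanLin u ∈ posSpace P
  rw [projPlus, LinearEquiv.apply_symm_apply, LinearMap.comp_apply]
  exact Submodule.coe_mem _

theorem projPlus_mem_boundaryLayerValues (hab : a < b) (u : V) :
    (matOp (projPlus P) u, 0) ∈ boundaryLayerValues P a b := by
  have h_le : posSpace P ≤ (boundaryLayerValues P a b).comap (LinearMap.inl 𝕜 V V) := by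
    refine Submodule.span_le.2 fun w ⟨μ, hμ, hw⟩ => ?_
    obtain ⟨f, g, h, h_values⟩ := exists_isBoundaryLayer_of_eigenvector (a := a) (b := b) hw
      hμ.ne' hab.ne' fun s hs hsb => div_neg_of_neg_of_pos (sub_neg.2 (hs.2.lt_of_ne hsb)) hμ
    exact ⟨f, g, h, h_values⟩
  exact h_le (projPlus_apply_mem P u)

theorem projMinus_mem_boundaryLayerValues (hab : a < b) (u : V) :
    (0, matOp (projMinus P) u) ∈ boundaryLayerValues P a b := by
  have h_le : posSpace (-P) ≤ (boundaryLayerValues P a b).comap (LinearMap.inr 𝕜 V V) := by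
    refine Submodule.span_le.2 fun w ⟨μ, hμ, hw⟩ => ?_
    have hw' : matOp P w = ((-μ : ℝ) : 𝕜) • w := by
      rw [RCLike.ofReal_neg, neg_smul, ← hw, map_neg, LinearMap.neg_apply, neg_neg]
      rfl
    obtain ⟨f, g, h, h_values⟩ := exists_isBoundaryLayer_of_eigenvector (a := a) (b := b) hw'
      (neg_ne_zero.2 hμ.ne') hab.ne fun s hs hsa =>
        div_neg_of_pos_of_neg (sub_pos.2 (hs.1.lt_of_ne' hsa)) (neg_lt_zero.2 hμ)
    exact ⟨f, g, h, fun lam => (h_values lam).symm⟩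
  exact h_le (projPlus_apply_mem (-P) u)

theorem GeneratesC0Semigroup.apply_sub_eq_zero_of_mem_boundaryLayerValues (hab : a < b)
    {P₀ : ℝ → Matrix (Fin n) (Fin n) 𝕜}
    (hP₀ : ∀ i j, MemLp (fun ξ => P₀ ξ i j) ∞ (intervalMeasure a b))
    {W : Matrix (Fin n) (Fin n ⊕ Fin n) 𝕜} (hA : GeneratesC0Semigroup (opA P P₀ W a b)) {v w : V}
    (h_mem : (v, w) ∈ boundaryLayerValues P a b) (hW : W *ᵥ Sum.elim v w = 0) :
    matOp P (v - w) = 0 := by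
  obtain ⟨f, g, h, h_values⟩ := h_mem
  obtain ⟨C, hC⟩ := exists_norm_trace_le hab hP₀ hA
  have h_tendsto := ((ENNReal.tendsto_toReal ENNReal.zero_ne_top).comp
    h.tendsto_residual).const_mul C
  rw [ENNReal.toReal_zero, mul_zero] at h_tendsto
  refine norm_le_zero_iff.1 (ge_of_tendsto h_tendsto (hC.mono fun lam h_lam => ?_))
  obtain ⟨rfl, rfl⟩ := h_values lam
  exact h_lam _ _ (h.isH1 lam) hW

theorem isUnit_of_generatesC0Semigroup (hab : a < b) (hP : P.IsHermitian) (hu : IsUnit P)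
    {P₀ : ℝ → Matrix (Fin n) (Fin n) 𝕜}
    (hP₀ : ∀ i j, MemLp (fun ξ => P₀ ξ i j) ∞ (intervalMeasure a b))
    {W : Matrix (Fin n) (Fin n ⊕ Fin n) 𝕜} (hA : GeneratesC0Semigroup (opA P P₀ W a b)) :
    IsUnit (W * Matrix.fromRows (projPlus P) (projMinus P)) := by
  refine Matrix.mulVec_injective_iff_isUnit.1
    ((injective_iff_map_eq_zero (Matrix.mulVecLin _)).2 fun u h_kernel => ?_)
  rw [Matrix.mulVecLin_apply, ← Matrix.mulVec_mulVec, Matrix.fromRows_mulVec] at h_kernel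
  set x : V := WithLp.toLp 2 u
  have h_mem : (matOp (projPlus P) x, matOp (projMinus P) x) ∈ boundaryLayerValues P a b := by
    have h := add_mem (projPlus_mem_boundaryLayerValues (P := P) hab x)
      (projMinus_mem_boundaryLayerValues hab x)
    rwa [Prod.mk_add_mk, add_zero, zero_add] at h
  have h_sub : P *ᵥ (projPlus P *ᵥ u - projMinus P *ᵥ u) = 0 := congrArg WithLp.ofLp
    (hA.apply_sub_eq_zero_of_mem_boundaryLayerValues hab hP₀ h_mem h_kernel)
  have h_eq : projPlus P *ᵥ u = projMinus P *ᵥ u := sub_eq_zero.1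
    (Matrix.mulVec_injective_of_isUnit hu (h_sub.trans (Matrix.mulVec_zero P).symm))
  have h_plus : projPlus P *ᵥ u = 0 := by
    rw [← projPlus_mul_projPlus hP, ← Matrix.mulVec_mulVec, h_eq, Matrix.mulVec_mulVec,
      projPlus_mul_projMinus hP, Matrix.zero_mulVec]
  rw [← Matrix.one_mulVec u, ← projPlus_add_projMinus hP hu, Matrix.add_mulVec, ← h_eq, h_plus,
    add_zero]

end BoundaryLayers

end HBCS

open HBCS in
theorem mainTheorem3_general {𝕜 : Type*} [RCLike 𝕜] {n : ℕ} {a b : ℝ} (hab : a < b)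
    (P₁ : Matrix (Fin n) (Fin n) 𝕜) (hP₁ : P₁.IsHermitian) (hP₁_inv : IsUnit P₁)
    (P₀ : ℝ → Matrix (Fin n) (Fin n) 𝕜)
    (hP₀ : ∀ i j, MemLp (fun ξ => P₀ ξ i j) ∞ (volume.restrict (Set.Icc a b)))
    (W : Matrix (Fin n) (Fin n ⊕ Fin n) 𝕜) :
    ∃ J L : Matrix (Fin n) (Fin n) 𝕜,
      W = Matrix.fromCols (J * Qplus P₁ - L * Qminus P₁) (J * Qminus P₁ - L * Qplus P₁) ∧
      (∀ J' L' : Matrix (Fin n) (Fin n) 𝕜,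
        W = Matrix.fromCols (J' * Qplus P₁ - L' * Qminus P₁) (J' * Qminus P₁ - L' * Qplus P₁) →
          J' = J ∧ L' = L) ∧
      J = W * Matrix.fromRows (Qplus P₁) (-Qminus P₁) * P₁⁻¹ ∧
      L = W * Matrix.fromRows (Qminus P₁) (-Qplus P₁) * P₁⁻¹ ∧
      List.TFAE [
        ∃ K M : Matrix (Fin n) (Fin n) 𝕜, IsUnit K ∧
          W = K * Matrix.fromCols (Qplus P₁ - M * Qminus P₁) (Qminus P₁ - M * Qplus P₁),
        IsUnit (W * Matrix.fromRows (projPlus P₁) (projMinus P₁)),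
        GeneratesC0Semigroup (opA P₁ P₀ W a b),
        IsUnit J] ∧
      ∀ K M : Matrix (Fin n) (Fin n) 𝕜, IsUnit K →
        W = K * Matrix.fromCols (Qplus P₁ - M * Qminus P₁) (Qminus P₁ - M * Qplus P₁) →
          K = W * Matrix.fromRows (Qplus P₁) (-Qminus P₁) * P₁⁻¹ ∧
          M = K⁻¹ * (W * Matrix.fromRows (Qminus P₁) (-Qplus P₁) * P₁⁻¹) := by
  set J := W * Matrix.fromRows (Qplus P₁) (-Qminus P₁) * P₁⁻¹
  set L := W * Matrix.fromRows (Qminus P₁) (-Qplus P₁) * P₁⁻¹ with hL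
  have hJL : W = Matrix.fromCols (J * Qplus P₁ - L * Qminus P₁) (J * Qminus P₁ - L * Qplus P₁) :=
    (eq_fromCols_iff hP₁ hP₁_inv).2 ⟨rfl, rfl⟩
  refine ⟨J, L, hJL, fun J' L' => (eq_fromCols_iff hP₁ hP₁_inv).1, rfl, rfl, ?_, fun K M hK h => ?_⟩
  · tfae_have 1 → 3 := fun ⟨K, M, hK, h⟩ =>
      h ▸ generatesC0Semigroup_opA hab hP₁ hP₁_inv hP₀ hK M
    tfae_have 3 → 2 := isUnit_of_generatesC0Semigroup hab hP₁ hP₁_inv hP₀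
    tfae_have 2 → 4 := fun h => by
      rwa [hJL, fromCols_mul_fromRows_proj hP₁,
        (isUnit_Qplus_add_Qminus hP₁ hP₁_inv).mul_right_iff] at h
    tfae_have 4 → 1 := fun h => ⟨J, J⁻¹ * L, h, (eq_mul_fromCols_iff hP₁ hP₁_inv).2
      ⟨rfl, Matrix.mul_nonsing_inv_cancel_left _ _ ((Matrix.isUnit_iff_isUnit_det J).1 h)⟩⟩
    tfae_finish
  · obtain ⟨hKJ, hKM⟩ := (eq_mul_fromCols_iff hP₁ hP₁_inv).1 h
    exact ⟨hKJ, by rw [hL, ← hKM,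
      Matrix.nonsing_inv_mul_cancel_left _ _ ((Matrix.isUnit_iff_isUnit_det K).1 hK)]⟩

open HBCS in
theorem mainTheorem3 {𝕜 : Type*} [RCLike 𝕜] {n : ℕ} {a b : ℝ} (hab : a < b)
    (P₁ : Matrix (Fin n) (Fin n) 𝕜) (hP₁ : P₁.IsHermitian) (hP₁_inv : IsUnit P₁)
    (P₀ : ℝ → Matrix (Fin n) (Fin n) 𝕜)
    (hP₀ : ∀ i j, MemLp (fun ξ => P₀ ξ i j) ∞ (volume.restrict (Set.Icc a b)))
    (W : Matrix (Fin n) (Fin n ⊕ Fin n) 𝕜) (hW : W.rank = n) :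
    ∃ J L : Matrix (Fin n) (Fin n) 𝕜,
      -- existence and uniqueness of the decomposition, and the formulas for `J` and `L`
      W = Matrix.fromCols (J * Qplus P₁ - L * Qminus P₁) (J * Qminus P₁ - L * Qplus P₁) ∧
      (∀ J' L' : Matrix (Fin n) (Fin n) 𝕜,
        W = Matrix.fromCols (J' * Qplus P₁ - L' * Qminus P₁) (J' * Qminus P₁ - L' * Qplus P₁) →
          J' = J ∧ L' = L) ∧
      J = W * Matrix.fromRows (Qplus P₁) (-Qminus P₁) * P₁⁻¹ ∧
      L = W * Matrix.fromRows (Qminus P₁) (-Qplus P₁) * P₁⁻¹ ∧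
      -- the equivalent statements
      List.TFAE [
        ∃ K M : Matrix (Fin n) (Fin n) 𝕜, IsUnit K ∧
          W = K * Matrix.fromCols (Qplus P₁ - M * Qminus P₁) (Qminus P₁ - M * Qplus P₁),
        IsUnit (W * Matrix.fromRows (projPlus P₁) (projMinus P₁)),
        GeneratesC0Semigroup (opA P₁ P₀ W a b),
        IsUnit J] ∧
      -- the formulas for `K` and `M`
      ∀ K M : Matrix (Fin n) (Fin n) 𝕜, IsUnit K →
        W = K * Matrix.fromCols (Qplus P₁ - M * Qminus P₁) (Qminus P₁ - M * Qplus P₁) →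
          K = W * Matrix.fromRows (Qplus P₁) (-Qminus P₁) * P₁⁻¹ ∧
          M = K⁻¹ * (W * Matrix.fromRows (Qminus P₁) (-Qplus P₁) * P₁⁻¹) :=
  mainTheorem3_general hab P₁ hP₁ hP₁_inv P₀ hP₀ W
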